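/- Let $M[k]$, $k\ge1$, be a generalized product: a contravariant functor $I\mapsto S_I$ from the category of the sets $J(k)=\{1,\dots,k\}$ with all maps between them to the category of connected manifolds with corners with interior b-maps, with $\dim M[k]=\mu+(k-1)\kappa$, which takes a map $I:J(k)\to J(l)$ to $S_I:M[l]\to M[k]$, injective maps to b-fibrations with connected fibres, and surjective maps to p-embeddings. (Compactness is not required.) Let $\Pi_L,\Pi_R:M[2]\to M[1]$ be the structure maps of $1\mapsto1$ and $1\mapsto2$; let $\Pi_S,\Pi_C,\Pi_F:M[3]\to M[2]$ be the structure maps of $(1,2)\mapsto(1,2),\ (1,3),\ (2,3)$ respectively; let $D:M[1]\to M[2]$ be the structure map of $J(2)\to J(1)$, and $D_{1,2}:M[2]\to M[3]$ that of $(1,2,3)\mapsto(1,1,2)$. Write $F_*$ for the b-differential of an interior b-map $F$ between b-tangent bundles ${}^bT$, and let $$E=D^*\operatorname{null}((\Pi_R)_*),\qquad \mathcal E=C^\infty(M[1];E).$$ Theorem. (1) Every $V\in\mathcal E$ lifts to a unique smooth section $W$ of $\operatorname{null}((\Pi_F)_*)$ over $D_{1,2}$ with $(\Pi_S)_*W=V\circ\Pi_S$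 (where $\Pi_S\circ D_{1,2}=D\circ\Pi_L$, and $D$ is identified with $M[1]$). (2) Since $\Pi_C\circ D_{1,2}=\mathrm{id}$, the push-forward $\tilde V=(\Pi_C)_*W$ is a section over $M[2]$; it is a smooth section of $\operatorname{null}((\Pi_R)_*)\subset{}^bTM[2]$ that restricts to $V$ on $D$. (3) There is a unique bracket on $\mathcal E$ given by $[V_1,V_2]=[\tilde V_1,\tilde V_2]\big|_D$ (commutator of b-vector fields on $M[2]$; in particular this restriction is a smooth section of $E$), and with this bracket and the anchor $$(\Pi_L)_*:\mathcal E\to C^\infty(M[1];{}^bTM[1])$$ $E$ is a Lie algebroid over $M[1]$. That is: $E$ is a smooth vector bundle of rank $\kappa$; the bracket is $\mathbb R$-bilinear, alternating and satisfies the Jacobi identity; the anchor is a linear bundle map that takes smooth sections to smooth b-vector fields and brackets to commutators of b-vector fields; and $[V,fW]=f[V,W]+\big(((\Pi_L)_*V)f\big)W$ for all $V,W\in\mathcal E$ and $f\in C^\infty(M[1])$. -/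

import Mathlib

open Set Filter Topology
open scoped Manifold ContDiff

universe u

/-! ### Manifolds with corners, b-maps -/

/-- A (finite-dimensional, second countable, Hausdorff, smooth) manifold with corners of
dimension `n`: it is modelled on `[0,∞)ⁿ`. -/
structure CornerManifold (n : ℕ) where
  carrier : Type u
  [top : TopologicalSpace carrier]
  [t2 : T2Space carrier]
  [sc : SecondCountableTopology carrier]
  [charted : ChartedSpace (EuclideanQuadrant n) carrier]
  [smooth : IsManifold (modelWithCornersEuclideanQuadrant n) ∞ carrier]

instance {n : ℕ} : CoeSort (CornerManifold.{u} n) (Type u) := ⟨CornerManifold.carrier⟩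

attribute [instance] CornerManifold.top CornerManifold.t2 CornerManifold.sc
  CornerManifold.charted CornerManifold.smooth

noncomputable section

namespace CornerManifold

variable {n m l : ℕ}

/-- `f` is smooth on a neighbourhood of `x`. -/
def SmoothNear (X : CornerManifold.{u} n) (f : X → ℝ) (x : X) : Prop :=
  ∀ᶠ y in 𝓝 x, ContMDiffAt (modelWithCornersEuclideanQuadrant n) 𝓘(ℝ, ℝ) ∞ f y

/-- Smooth maps between manifolds with corners. -/
def SmoothMap (X : CornerManifold.{u} n) (Y : CornerManifold.{u} m) (F : X → Y) : Prop :=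
  ContMDiff (modelWithCornersEuclideanQuadrant n) (modelWithCornersEuclideanQuadrant m) ∞ F

/-- Smooth real-valued functions. -/
def SmoothFun (X : CornerManifold.{u} n) (f : X → ℝ) : Prop :=
  ContMDiff (modelWithCornersEuclideanQuadrant n) 𝓘(ℝ, ℝ) ∞ f

/-- `φ` is a smooth coordinate system of `X` around `x`, with values in `[0,∞)ⁿ`. The coordinates
that vanish at `x` are the boundary coordinates at `x`; the others (which are positive at `x`, as
can always be arranged by a translation) are the interior coordinates at `x`. -/
def IsChartAt (X : CornerManifold.{u} n)
    (φ : OpenPartialHomeomorph X (EuclideanQuadrant n)) (x : X) : Prop :=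
  φ ∈ IsManifold.maximalAtlas (modelWithCornersEuclideanQuadrant n) ∞ X ∧ x ∈ φ.source

/-- `g` is an *interior b-function* at `x`: near `x` it is of the form `u · ∏ⱼ xⱼ ^ aⱼ` with `u`
smooth and positive, the `xⱼ` coordinates, and the `aⱼ` non-negative integers. (Powers of
coordinates that do not vanish at `x` can be absorbed in `u`.) -/
def IsBFun (X : CornerManifold.{u} n) (g : X → ℝ) (x : X) : Prop :=
  ∃ φ : OpenPartialHomeomorph X (EuclideanQuadrant n), X.IsChartAt φ x ∧
    ∃ (a : Fin n → ℕ) (v : X → ℝ), X.SmoothNear v x ∧ 0 < v x ∧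
      ∀ᶠ y in 𝓝 x, g y = v y * ∏ j, (φ y).1 j ^ a j

/-- Interior b-maps: smooth maps which pull boundary defining functions back to products of
powers of boundary defining functions and a positive smooth function. -/
def IsInteriorBMap (X : CornerManifold.{u} n) (Y : CornerManifold.{u} m) (F : X → Y) : Prop :=
  SmoothMap X Y F ∧ ∀ x g, Y.IsBFun g (F x) → X.IsBFun (g ∘ F) x

/-- b-fibrations: surjective interior b-maps `F` such that near each point `x` there are coordinates
`φ` near `x` and `ψ` near `F x`, in which each interior coordinate `ψᵢ` pulls back to one of the
interior coordinates `φⱼ`, each boundary coordinate `ψᵢ` pulls back to a product of powers of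
boundary coordinates `φⱼ`, and no `φⱼ` is involved in the pull-backs of two different `ψᵢ`. -/
def IsBFibration (X : CornerManifold.{u} n) (Y : CornerManifold.{u} m) (F : X → Y) : Prop :=
  IsInteriorBMap X Y F ∧ Function.Surjective F ∧
  ∀ x, ∃ (φ : OpenPartialHomeomorph X (EuclideanQuadrant n))
      (ψ : OpenPartialHomeomorph Y (EuclideanQuadrant m)) (a : Fin m → Fin n → ℕ),
    X.IsChartAt φ x ∧ Y.IsChartAt ψ (F x) ∧
    (∀ i, ∀ᶠ y in 𝓝 x, (ψ (F y)).1 i = ∏ j, (φ y).1 j ^ a i j) ∧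
    (∀ i, (ψ (F x)).1 i = 0 → ∀ j, a i j ≠ 0 → (φ x).1 j = 0) ∧
    (∀ i, (ψ (F x)).1 i ≠ 0 → ∃ j, (φ x).1 j ≠ 0 ∧ a i = Pi.single j 1) ∧
    (∀ i i' j, a i j ≠ 0 → a i' j ≠ 0 → i = i')

/-- p-embeddings: diffeomorphisms onto a p-submanifold, i.e. closed embeddings such that near each
point there are coordinates `χ` on the domain and `φ` on the target for which some of the `φⱼ`
restrict to the `χᵢ` and the remaining `φⱼ` are constant on the image (which is therefore given
locally by fixing the values of those `φⱼ`). -/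
def IsPEmbedding (X : CornerManifold.{u} n) (Y : CornerManifold.{u} m) (F : X → Y) : Prop :=
  SmoothMap X Y F ∧ IsClosedEmbedding F ∧
  ∀ x, ∃ (χ : OpenPartialHomeomorph X (EuclideanQuadrant n))
      (φ : OpenPartialHomeomorph Y (EuclideanQuadrant m)) (τ : Fin n → Fin m),
    X.IsChartAt χ x ∧ Y.IsChartAt φ (F x) ∧ Function.Injective τ ∧
    (∀ i, ∀ᶠ y in 𝓝 x, (φ (F y)).1 (τ i) = (χ y).1 i) ∧
    (∀ j, j ∉ range τ → ∀ᶠ y in 𝓝 x, (φ (F y)).1 j = (φ (F x)).1 j)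

/-! ### The b-tangent bundle

A b-tangent vector at `x` is represented by its action `g ↦ ξ (log g)` on the logarithms of interior
b-functions `g` at `x`. Every smooth function `f` is the logarithm of the b-function `exp f`, and
`ξ` acts on these as a derivation. In coordinates with `xⱼ` the boundary and `yᵢ` the
interior coordinates at `x`, the vector `∑ aⱼ xⱼ∂_{xⱼ} + ∑ bᵢ ∂_{yᵢ}` is the functional with
`xⱼ ↦ aⱼ` and `exp yᵢ ↦ bᵢ`. -/

/-- The real vector space in which all b-tangent spaces of `X` are realised. -/
abbrev LogFunctional (X : CornerManifold.{u} n) : Type u := (X → ℝ) → ℝ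

/-- The derivative of the smooth function `f` along the b-tangent vector `ξ`. -/
def bDeriv {X : CornerManifold.{u} n} (ξ : LogFunctional X) (f : X → ℝ) : ℝ :=
  ξ (fun y => Real.exp (f y))

/-- The b-tangent space `ᵇTₓX`. Functionals are required to be zero on functions that are not
interior b-functions at `x`, where they carry no meaning. -/
def bTangentSpace (X : CornerManifold.{u} n) (x : X) : Submodule ℝ (LogFunctional X) where
  carrier := {ξ |
    (∀ g, ¬ X.IsBFun g x → ξ g = 0) ∧
    (∀ g h, X.IsBFun g x → g =ᶠ[𝓝 x] h → ξ g = ξ h) ∧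
    (∀ g h, X.IsBFun g x → X.IsBFun h x → ξ (fun y => g y * h y) = ξ g + ξ h) ∧
    (∀ (c : ℝ) f, X.SmoothNear f x → bDeriv ξ (fun y => c * f y) = c * bDeriv ξ f) ∧
    (∀ f h, X.SmoothNear f x → X.SmoothNear h x →
      bDeriv ξ (fun y => f y * h y) = f x * bDeriv ξ h + h x * bDeriv ξ f) ∧
    (∀ g, X.IsBFun g x → bDeriv ξ g = g x * ξ g)}
  zero_mem' := by simp [bDeriv]
  add_mem' := by
    rintro ξ η ⟨h1, h2, h3, h4, h5, h6⟩ ⟨k1, k2, k3, k4, k5, k6⟩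
    simp only [bDeriv] at *
    refine ⟨fun g hg => ?_, fun g h hg hgh => ?_, fun g h hg hh => ?_, fun c f hf => ?_,
      fun f h hf hh => ?_, fun g hg => ?_⟩ <;> simp only [Pi.add_apply]
    · rw [h1 g hg, k1 g hg, add_zero]
    · rw [h2 g h hg hgh, k2 g h hg hgh]
    · rw [h3 g h hg hh, k3 g h hg hh]; ring
    · rw [h4 c f hf, k4 c f hf]; ring
    · rw [h5 f h hf hh, k5 f h hf hh]; ring
    · rw [h6 g hg, k6 g hg]; ring
  smul_mem' := by
    rintro r ξ ⟨h1, h2, h3, h4, h5, h6⟩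
    simp only [bDeriv] at *
    refine ⟨fun g hg => ?_, fun g h hg hgh => ?_, fun g h hg hh => ?_, fun c f hf => ?_,
      fun f h hf hh => ?_, fun g hg => ?_⟩ <;> simp only [Pi.smul_apply, smul_eq_mul]
    · rw [h1 g hg, mul_zero]
    · rw [h2 g h hg hgh]
    · rw [h3 g h hg hh]; ring
    · rw [h4 c f hf]; ring
    · rw [h5 f h hf hh]; ring
    · rw [h6 g hg]; ring

open Classical in
/-- The b-differential `F_* : ᵇTₓX → ᵇT_{F x}Y` of an interior b-map, `(F_* ξ)(log g) = ξ (log F^*g)`,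
as a linear map of the ambient spaces. -/
def bDiff {X : CornerManifold.{u} n} {Y : CornerManifold.{u} m} (F : X → Y) (x : X) :
    LogFunctional X →ₗ[ℝ] LogFunctional Y where
  toFun ξ := fun g => if Y.IsBFun g (F x) then ξ (g ∘ F) else 0
  map_add' ξ η := by funext g; by_cases h : Y.IsBFun g (F x) <;> simp [h]
  map_smul' c ξ := by funext g; by_cases h : Y.IsBFun g (F x) <;> simp [h]

/-- The fibre at `x` of `null(F_*) ⊂ ᵇTX`. -/
def nullSpace {X : CornerManifold.{u} n} {Y : CornerManifold.{u} m} (F : X → Y) (x : X) :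
    Submodule ℝ (LogFunctional X) :=
  X.bTangentSpace x ⊓ LinearMap.ker (bDiff F x)

/-- `V` is smooth near `x`, as a section of the pull-back `F^* ᵇTY` of the b-tangent bundle under
`F : X → Y`: its components `x' ↦ V(x') (log g)` are smooth. -/
def SmoothSectionAt {X : CornerManifold.{u} n} {Y : CornerManifold.{u} m} (F : X → Y)
    (V : X → LogFunctional Y) (x : X) : Prop :=
  ∀ g, Y.IsBFun g (F x) → X.SmoothNear (fun x' => V x' g) x

/-- The space of smooth global sections of a family of subspaces `E x ⊂ ᵇT_{F x}Y`, `x ∈ X`. -/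
def smoothSections {X : CornerManifold.{u} n} {Y : CornerManifold.{u} m} (F : X → Y)
    (E : X → Submodule ℝ (LogFunctional Y)) : Submodule ℝ (X → LogFunctional Y) where
  carrier := {V | (∀ x, V x ∈ E x) ∧ ∀ x, SmoothSectionAt F V x}
  zero_mem' := ⟨fun x => (E x).zero_mem, fun _ _ _ =>
    Eventually.of_forall fun _ => contMDiffAt_const⟩
  add_mem' := fun ha hb => ⟨fun x => (E x).add_mem (ha.1 x) (hb.1 x), fun x g hg =>
    ((ha.2 x g hg).and (hb.2 x g hg)).mono fun _ h => h.1.add h.2⟩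
  smul_mem' := fun c _ ha => ⟨fun x => (E x).smul_mem c (ha.1 x), fun x g hg =>
    (ha.2 x g hg).mono fun _ h => contMDiffAt_const.mul h⟩

/-- The product of a smooth function and a smooth section. -/
def smulSection {X : CornerManifold.{u} n} {Y : CornerManifold.{u} m} {F : X → Y}
    {E : X → Submodule ℝ (LogFunctional Y)} (f : X → ℝ) (hf : X.SmoothFun f)
    (V : smoothSections F E) : smoothSections F E :=
  ⟨fun x => f x • V.1 x, fun x => (E x).smul_mem _ (V.2.1 x), fun x g hg =>
    (V.2.2 x g hg).mono fun y h => (hf y).mul h⟩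

/-- The family `E x ⊂ ᵇT_{F x}Y` is a smooth vector subbundle of rank `r` of `F^* ᵇTY`: locally
there are `r` smooth sections forming a basis of each fibre. -/
def IsSmoothSubbundle {X : CornerManifold.{u} n} {Y : CornerManifold.{u} m} (F : X → Y)
    (E : X → Submodule ℝ (LogFunctional Y)) (r : ℕ) : Prop :=
  (∀ x, E x ≤ Y.bTangentSpace (F x)) ∧
  ∀ x₀, ∃ U : Set X, IsOpen U ∧ x₀ ∈ U ∧ ∃ s : Fin r → X → LogFunctional Y,
    (∀ i, ∀ x ∈ U, SmoothSectionAt F (s i) x) ∧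
    ∀ x ∈ U, LinearIndependent ℝ (fun i => s i x) ∧
      Submodule.span ℝ (range fun i => s i x) = E x

/-- The space `𝒱_b(X) = C^∞(X; ᵇTX)` of smooth b-vector fields. -/
def bVectorFields (X : CornerManifold.{u} n) : Submodule ℝ (X → LogFunctional X) :=
  smoothSections id X.bTangentSpace

open Classical in
/-- The commutator of b-vector fields, `[V, W](log g) = V(W(log g)) - W(V(log g))`. -/
def bBracket {X : CornerManifold.{u} n} (V W : X → LogFunctional X) : X → LogFunctional X :=
  fun x g => if X.IsBFun g x then
    bDeriv (V x) (fun y => W y g) - bDeriv (W x) (fun y => V y g) else 0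

/-- The family `E` of subspaces of the fibres of `F^* ᵇTY`, with the anchor given on fibres by the
linear maps `anchor x` and the given bracket of smooth sections, is a Lie algebroid of rank `r`
over `X` (in the category of manifolds with corners: the anchor maps to `ᵇTX`). -/
structure IsLieAlgebroid {X : CornerManifold.{u} n} {Y : CornerManifold.{u} m} (F : X → Y)
    (E : X → Submodule ℝ (LogFunctional Y)) (r : ℕ)
    (anchor : X → LogFunctional Y →ₗ[ℝ] LogFunctional X)
    (bracket : smoothSections F E → smoothSections F E → smoothSections F E) : Prop where
  vectorBundle : IsSmoothSubbundle F E r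
  add_left : ∀ U V W, bracket (U + V) W = bracket U W + bracket V W
  smul_left : ∀ (c : ℝ) V W, bracket (c • V) W = c • bracket V W
  add_right : ∀ U V W, bracket U (V + W) = bracket U V + bracket U W
  smul_right : ∀ (c : ℝ) V W, bracket V (c • W) = c • bracket V W
  bracket_self : ∀ V, bracket V V = 0
  jacobi : ∀ U V W,
    bracket U (bracket V W) + bracket V (bracket W U) + bracket W (bracket U V) = 0
  anchor_mem : ∀ V : smoothSections F E, (fun x => anchor x (V.1 x)) ∈ X.bVectorFields
  anchor_bracket : ∀ V W : smoothSections F E, (fun x => anchor x ((bracket V W).1 x)) =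
    bBracket (fun x => anchor x (V.1 x)) (fun x => anchor x (W.1 x))
  leibniz : ∀ (V W : smoothSections F E) (f : X → ℝ) (hf : X.SmoothFun f) (x : X),
    (bracket V (smulSection f hf W)).1 x =
      f x • (bracket V W).1 x + bDeriv (anchor x (V.1 x)) f • W.1 x

end CornerManifold

/-! ### Generalized products -/

/-- A generalized product: a contravariant functor from the category of the sets
`J(k) = {1, …, k}`, `k ≥ 1`, with all maps between them, to manifolds with corners and interior
b-maps, under which injections go to b-fibrations and surjections to p-embeddings.
The set `J(k+1)` is represented by `Fin (k+1)` and `M k` stands for the space `M[k+1]`. -/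
structure GeneralizedProduct (μ κ : ℕ) where
  M : ∀ k : ℕ, CornerManifold.{u} (μ + k * κ)
  S : ∀ {k l : ℕ}, (Fin (k + 1) → Fin (l + 1)) → M l → M k
  connected : ∀ k, ConnectedSpace (M k)
  map_id : ∀ k, S (id : Fin (k + 1) → Fin (k + 1)) = id
  map_comp : ∀ {j k l : ℕ} (K : Fin (j + 1) → Fin (k + 1)) (I : Fin (k + 1) → Fin (l + 1)),
    S (I ∘ K) = S K ∘ S I
  bMap : ∀ {k l : ℕ} (I : Fin (k + 1) → Fin (l + 1)),
    CornerManifold.IsInteriorBMap (M l) (M k) (S I)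
  bFibration : ∀ {k l : ℕ} (I : Fin (k + 1) → Fin (l + 1)), Function.Injective I →
    CornerManifold.IsBFibration (M l) (M k) (S I)
  pEmbedding : ∀ {k l : ℕ} (I : Fin (k + 1) → Fin (l + 1)), Function.Surjective I →
    CornerManifold.IsPEmbedding (M l) (M k) (S I)
  connected_fibre : ∀ {k l : ℕ} (I : Fin (k + 1) → Fin (l + 1)), Function.Injective I →
    ∀ p, IsConnected (S I ⁻¹' {p})

namespace GeneralizedProduct

open CornerManifold

variable {μ κ : ℕ} (P : GeneralizedProduct.{u} μ κ)

/-- `Π_L : M[2] → M[1]`, from `1 ↦ 1`. -/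
def projL : P.M 1 → P.M 0 := P.S (![0] : Fin 1 → Fin 2)

/-- `Π_R : M[2] → M[1]`, from `1 ↦ 2`. -/
def projR : P.M 1 → P.M 0 := P.S (![1] : Fin 1 → Fin 2)

/-- `Π_S : M[3] → M[2]`, from `1 ↦ 1, 2 ↦ 2`. -/
def projS : P.M 2 → P.M 1 := P.S (![0, 1] : Fin 2 → Fin 3)

/-- `Π_C : M[3] → M[2]`, from `1 ↦ 1, 2 ↦ 3`. -/
def projC : P.M 2 → P.M 1 := P.S (![0, 2] : Fin 2 → Fin 3)

/-- `Π_F : M[3] → M[2]`, from `1 ↦ 2, 2 ↦ 3`. -/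
def projF : P.M 2 → P.M 1 := P.S (![1, 2] : Fin 2 → Fin 3)

/-- The diagonal `D : M[1] → M[2]`. -/
def diag : P.M 0 → P.M 1 := P.S (![0, 0] : Fin 2 → Fin 1)

/-- The partial diagonal `D_{1,2} : M[2] → M[3]`, from `1 ↦ 1, 2 ↦ 1, 3 ↦ 2`. -/
def diag12 : P.M 1 → P.M 2 := P.S (![0, 0, 1] : Fin 3 → Fin 2)

/-- The fibres of `E = D^* null((Π_R)_*)` over `M[1]`. -/
def E (p : P.M 0) : Submodule ℝ (LogFunctional (P.M 1)) := nullSpace P.projR (P.diag p)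

/-- The smooth sections of `E` over `M[1]`. -/
abbrev sections : Submodule ℝ (P.M 0 → LogFunctional (P.M 1)) := smoothSections P.diag P.E

/-- The anchor `(Π_L)_* : E_p → ᵇT_p M[1]`. -/
def anchor (p : P.M 0) : LogFunctional (P.M 1) →ₗ[ℝ] LogFunctional (P.M 0) :=
  bDiff P.projL (P.diag p)

/-- `W` is a lift of the section `V` of `E`: a smooth section of `null((Π_F)_*)` over the partial
diagonal `D_{1,2}` with `(Π_S)_* W = V ∘ Π_S`. Here `D_{1,2}` is parametrised by `M[2]` and
`Π_S ∘ D_{1,2} = D ∘ Π_L`, so that `V ∘ Π_S` becomes `V ∘ Π_L`. -/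
def IsLift (V : P.M 0 → LogFunctional (P.M 1)) (W : P.M 1 → LogFunctional (P.M 2)) : Prop :=
  W ∈ smoothSections P.diag12 (fun q => nullSpace P.projF (P.diag12 q)) ∧
    ∀ q, bDiff P.projS (P.diag12 q) (W q) = V (P.projL q)

/-- The push-forward `(Π_C)_* W` of a section over `D_{1,2}`, where `Π_C ∘ D_{1,2} = id`. -/
def pushC (W : P.M 1 → LogFunctional (P.M 2)) : P.M 1 → LogFunctional (P.M 1) :=
  fun q => bDiff P.projC (P.diag12 q) (W q)

end GeneralizedProduct

end

/-!
# The Lie algebroid of a generalized product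

*Why the lift exists and is unique.* At a point of a partial diagonal, where the first two factors
agree, the projection to the first two factors maps the vectors tangent to the first factor into
`E`. It is onto: being a b-fibration it has a surjective b-differential, and subtracting from a
preimage its component along the partial diagonal yields a vector tangent to the first factor
(`GeneralizedProduct.isLiftAt_sub`). Both spaces have dimension `κ`, so it is an isomorphism
(`GeneralizedProduct.IsLiftAt.unique`). The preimage can be chosen smoothly, so the lift of a smooth
section is smooth.

*Why the bracket is a Lie algebroid bracket.* The same construction works on every `M[l+1]` and
yields for each section `V` of `E` a b-vector field `rightInvariant V l`, to be thought of as `V`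
acting on the first factor. For `l = 0` it is the image of `V` under the anchor, for `l = 1` the
field `(Π_C)_* W` of the theorem. The fields with different `l` are related under the structure maps
that keep the first factor apart from the others (`GeneralizedProduct.bDiff_rightInvariant`), and
annihilated by those that forget it. Since commutators of related fields are related, the commutator
of two of these fields on `M[3]` is, at the partial diagonal, the lift of the bracket; hence
commutators of right-invariant fields are right-invariant
(`GeneralizedProduct.rightInvariant_bracket`). The identities of a Lie algebroid are then those of
the commutator of b-vector fields on `M[2]`.

*The local theory.* In coordinates `φ` the b-tangent space is `ℝⁿ`, with basis `φⱼ ∂/∂φⱼ`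
(`CornerManifold.bFrame`), smoothly in the base point. Hadamard's lemma, up to the boundary of the
quadrant, shows that these vectors span; that they are well defined rests on the invariance of the
form `v · ∏ⱼ φⱼ ^ aⱼ` of interior b-functions under changes of coordinates
(`CornerManifold.IsBFun.exists_hasBForm`), as the boundary coordinates of two coordinate systems are
permutations of each other up to positive smooth factors. The b-differential of a b-fibration is a
constant matrix with a right inverse in suitable coordinates
(`CornerManifold.IsBFibration.exists_matrix`), whence smooth local lifts and the bundle structure
of null spaces.
-/

/-! ### Hadamard's lemma on convex sets -/

section ParametricIntegral

variable {E : Type} [NormedAddCommGroup E] [NormedSpace ℝ E]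

/-- Differentiation under the integral sign within a convex set of parameters: by the mean value
inequality the error of the linear approximation is uniform in the integration variable. -/
theorem hasFDerivWithinAt_integral_of_convex {F : Type} [NormedAddCommGroup F] [NormedSpace ℝ F]
    {s : Set E} (hs : Convex ℝ s) {h : E → ℝ → F} {h' : E → ℝ → E →L[ℝ] F}
    (hc : ∀ z ∈ s, ContinuousOn (h z) (Icc 0 1))
    (hd : ∀ t ∈ Icc (0 : ℝ) 1, ∀ z ∈ s, HasFDerivWithinAt (fun z => h z t) (h' z t) s z)
    (hc' : ContinuousOn (Function.uncurry h') (s ×ˢ Icc 0 1)) {z : E} (hz : z ∈ s) :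
    HasFDerivWithinAt (fun z => ∫ t in (0 : ℝ)..1, h z t) (∫ t in (0 : ℝ)..1, h' z t) s z := by
  have hint : ∀ w ∈ s, IntervalIntegrable (h w) MeasureTheory.volume 0 1 := fun w hw =>
    ContinuousOn.intervalIntegrable (by simpa using hc w hw)
  have hcz : ∀ w ∈ s, ContinuousOn (h' w) (Icc 0 1) := fun w hw =>
    hc'.comp (f := fun t => (w, t)) (by fun_prop) (fun t ht => ⟨hw, ht⟩)
  have hint' : IntervalIntegrable (h' z) MeasureTheory.volume 0 1 :=
    ContinuousOn.intervalIntegrable (by simpa using hcz z hz)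
  rw [hasFDerivWithinAt_iff_isLittleO, Asymptotics.isLittleO_iff]
  intro ε hε
  obtain ⟨v, hv, hvε⟩ := isCompact_Icc.mem_uniformity_of_prod hc' hz (Metric.dist_mem_uniformity hε)
  obtain ⟨δ, hδ, hball⟩ := Metric.mem_nhdsWithin_iff.1 hv
  filter_upwards [inter_mem self_mem_nhdsWithin
    (mem_nhdsWithin_of_mem_nhds (Metric.ball_mem_nhds z hδ))] with w hw
  have key : ∀ t ∈ Icc (0 : ℝ) 1, ‖h w t - h z t - h' z t (w - z)‖ ≤ ε * ‖w - z‖ := by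
    intro t ht
    have hcv : Convex ℝ (s ∩ Metric.ball z δ) := hs.inter (convex_ball z δ)
    refine hcv.norm_image_sub_le_of_norm_hasFDerivWithin_le' (f := fun w => h w t)
      (f' := fun w => h' w t) (fun y hy => (hd t ht y hy.1).mono inter_subset_left) ?_
      ⟨hz, Metric.mem_ball_self hδ⟩ hw
    intro y hy
    have := hvε y (hball ⟨hy.2, hy.1⟩) t ht
    simp only [mem_ofPred_eq, dist_eq_norm] at this
    exact this.le
  have e : (∫ t in (0 : ℝ)..1, h w t) - (∫ t in (0 : ℝ)..1, h z t)
      - (∫ t in (0 : ℝ)..1, h' z t) (w - z)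
      = ∫ t in (0 : ℝ)..1, (h w t - h z t - h' z t (w - z)) := by
    rw [intervalIntegral.integral_sub ((hint w hw.1).sub (hint z hz)),
      intervalIntegral.integral_sub (hint w hw.1) (hint z hz),
      ContinuousLinearMap.intervalIntegral_apply hint']
    exact ((ContinuousLinearMap.apply ℝ F (w - z)).continuous.comp_continuousOn
      (hcz z hz)).intervalIntegrable_of_Icc zero_le_one
  rw [e]
  refine (intervalIntegral.norm_integral_le_of_norm_le_const (C := ε * ‖w - z‖) ?_).trans (by simp)
  intro t ht
  rw [uIoc_of_le zero_le_one] at ht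
  exact key t ⟨ht.1.le, ht.2⟩

/-- Differentiation under the integral sign, to all orders and up to the boundary of a convex set
of parameters. -/
theorem contDiffOn_integral_of_convex {s : Set E} (hs : Convex ℝ s) (hu : UniqueDiffOn ℝ s)
    (n : ℕ) : ∀ {F : Type} [NormedAddCommGroup F] [NormedSpace ℝ F] {h : E → ℝ → F},
    ContDiffOn ℝ ∞ (Function.uncurry h) (s ×ˢ Icc 0 1) →
    ContDiffOn ℝ n (fun z => ∫ t in (0 : ℝ)..1, h z t) s := by
  have hu' : UniqueDiffOn ℝ (s ×ˢ Icc (0 : ℝ) 1) := hu.prod (uniqueDiffOn_Icc zero_lt_one)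
  -- The derivative is again an integral of the same kind, so the orders are climbed by induction
  -- over all target spaces at once.
  have main : ∀ {F : Type} [NormedAddCommGroup F] [NormedSpace ℝ F] {h : E → ℝ → F},
      ContDiffOn ℝ ∞ (Function.uncurry h) (s ×ˢ Icc 0 1) →
      ∃ h' : E → ℝ → E →L[ℝ] F, ContDiffOn ℝ ∞ (Function.uncurry h') (s ×ˢ Icc 0 1) ∧
        ∀ z ∈ s, HasFDerivWithinAt (fun z => ∫ t in (0 : ℝ)..1, h z t)
          (∫ t in (0 : ℝ)..1, h' z t) s z := by
    intro F _ _ h hh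
    let h' : E → ℝ → E →L[ℝ] F := fun z t =>
      (fderivWithin ℝ (Function.uncurry h) (s ×ˢ Icc (0 : ℝ) 1) (z, t)).comp
        (ContinuousLinearMap.inl ℝ E ℝ)
    have hh' : ContDiffOn ℝ ∞ (Function.uncurry h') (s ×ˢ Icc 0 1) :=
      (hh.fderivWithin hu' (by simp)).clm_comp contDiffOn_const
    refine ⟨h', hh', fun z hz => hasFDerivWithinAt_integral_of_convex hs ?_ ?_ hh'.continuousOn hz⟩
    · intro w hw
      exact hh.continuousOn.comp (f := fun t => (w, t)) (by fun_prop) (fun t ht => ⟨hw, ht⟩)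
    · intro t ht w hw
      have h1 := (hh.differentiableOn (by simp) (w, t) ⟨hw, ht⟩).hasFDerivWithinAt
      have h2 : HasFDerivWithinAt (fun w : E => (w, t)) (ContinuousLinearMap.inl ℝ E ℝ) s w :=
        (hasFDerivAt_prodMk_left w t).hasFDerivWithinAt
      exact h1.comp w h2 (show MapsTo (fun w : E => (w, t)) s (s ×ˢ Icc 0 1) from
        fun y hy => ⟨hy, ht⟩)
  induction n with
  | zero =>
    intro F _ _ h hh
    obtain ⟨h', -, hd⟩ := main hh
    exact contDiffOn_zero.2 fun z hz => (hd z hz).continuousWithinAt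
  | succ n ih =>
    intro F _ _ h hh
    obtain ⟨h', hh', hd⟩ := main hh
    push_cast
    rw [contDiffOn_succ_iff_fderivWithin hu]
    refine ⟨fun z hz => (hd z hz).differentiableWithinAt, by simp, ?_⟩
    exact (ih hh').congr fun z hz => (hd z hz).fderivWithin (hu z hz)

/-- Hadamard's lemma on a convex set, relative to a smooth map `P` of the set to itself: integration
of the derivative of `k` along `P z + t (z - P z)` expresses `k z - k (P z)` through `z - P z` with
smooth coefficients. -/
theorem exists_hadamard_of_convex {s : Set E} (hs : Convex ℝ s) (hu : UniqueDiffOn ℝ s)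
    {k : E → ℝ} (hk : ContDiffOn ℝ ∞ k s) {P : E → E} (hP : ContDiff ℝ ∞ P) (hPs : MapsTo P s s) :
    ∃ H : E → E →L[ℝ] ℝ, ContDiffOn ℝ ∞ H s ∧ ∀ z ∈ s, k z - k (P z) = H z (z - P z) := by
  have hmem : ∀ z ∈ s, ∀ t ∈ Icc (0 : ℝ) 1, P z + t • (z - P z) ∈ s := fun z hz t ht =>
    hs.add_smul_sub_mem (hPs hz) hz ht
  let h : E → ℝ → E →L[ℝ] ℝ := fun z t => fderivWithin ℝ k s (P z + t • (z - P z))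
  have hh : ContDiffOn ℝ ∞ (Function.uncurry h) (s ×ˢ Icc 0 1) := by
    refine (hk.fderivWithin hu (m := ∞) (by simp)).comp
      (f := fun q : E × ℝ => P q.1 + q.2 • (q.1 - P q.1)) (ContDiff.contDiffOn ?_) ?_
    · have := hP.comp (contDiff_fst (𝕜 := ℝ) (E := E) (F := ℝ))
      exact this.add (contDiff_snd.smul (contDiff_fst.sub this))
    · rintro ⟨z, t⟩ ⟨hz, ht⟩
      exact hmem z hz t ht
  refine ⟨fun z => ∫ t in (0 : ℝ)..1, h z t,
    contDiffOn_infty.2 fun n => contDiffOn_integral_of_convex hs hu n hh, fun z hz => ?_⟩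
  have hhc : ContinuousOn (h z) (Icc 0 1) :=
    hh.continuousOn.comp (f := fun t => (z, t)) (by fun_prop) (fun t ht => ⟨hz, ht⟩)
  have hd : ∀ t ∈ Icc (0 : ℝ) 1, HasDerivWithinAt (fun t : ℝ => k (P z + t • (z - P z)))
      (h z t (z - P z)) (Icc 0 1) t := by
    intro t ht
    have h1 := (hk.differentiableOn (by simp) _ (hmem z hz t ht)).hasFDerivWithinAt
    have h2 : HasDerivWithinAt (fun t : ℝ => P z + t • (z - P z)) (z - P z) (Icc 0 1) t := by
      simpa using (((hasDerivAt_id t).smul_const (z - P z)).const_add (P z)).hasDerivWithinAt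
    exact h1.comp_hasDerivWithinAt t h2 fun r hr => hmem z hz r hr
  rw [ContinuousLinearMap.intervalIntegral_apply
    (ContinuousOn.intervalIntegrable_of_Icc zero_le_one hhc)]
  rw [intervalIntegral.integral_eq_sub_of_hasDerivAt_of_le zero_le_one
    (fun t ht => (hd t ht).continuousWithinAt)
    (fun t ht => (hd t ⟨ht.1.le, ht.2.le⟩).hasDerivAt (Icc_mem_nhds ht.1 ht.2))]
  · simp
  · exact ((ContinuousLinearMap.apply ℝ ℝ (z - P z)).continuous.comp_continuousOn
      hhc).intervalIntegrable_of_Icc zero_le_one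

end ParametricIntegral

noncomputable section

namespace CornerManifold
variable {n m l : ℕ}

/-! ### Calculus in a coordinate system -/

local notation "𝓒" => modelWithCornersEuclideanQuadrant

/-- The model `[0,∞)ⁿ`, as a subset of `ℝⁿ`. -/
def quadrant (n : ℕ) : Set (EuclideanSpace ℝ (Fin n)) := {z | ∀ i, 0 ≤ z i}

theorem range_model : range (𝓒 n) = quadrant n := range_euclideanQuadrant n

theorem convex_quadrant : Convex ℝ (quadrant n) := EuclideanQuadrant.convex

theorem uniqueDiffOn_quadrant : UniqueDiffOn ℝ (quadrant n) :=
  range_model (n := n) ▸ (𝓒 n).uniqueDiffOn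

theorem uniqueDiffOn_ball_inter_quadrant (z : EuclideanSpace ℝ (Fin n)) (r : ℝ) :
    UniqueDiffOn ℝ (Metric.ball z r ∩ quadrant n) := by
  rw [inter_comm]
  exact uniqueDiffOn_quadrant.inter Metric.isOpen_ball

theorem convex_ball_inter_quadrant (z : EuclideanSpace ℝ (Fin n)) (r : ℝ) :
    Convex ℝ (Metric.ball z r ∩ quadrant n) := (convex_ball z r).inter convex_quadrant

variable {X : CornerManifold.{u} n} {φ : OpenPartialHomeomorph X (EuclideanQuadrant n)} {x : X}

/-- The inverse of the coordinate system `φ`, extended to `ℝⁿ`. -/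
def invChart {X : CornerManifold.{u} n} (φ : OpenPartialHomeomorph X (EuclideanQuadrant n)) :
    EuclideanSpace ℝ (Fin n) → X := (φ.extend (𝓒 n)).symm

theorem coord_mem_quadrant (y : X) : (φ y).1 ∈ quadrant n := (φ y).2

theorem invChart_coord {y : X} (hy : y ∈ φ.source) : invChart φ (φ y).1 = y :=
  φ.extend_left_inv (I := 𝓒 n) hy

theorem IsChartAt.eventually (h : X.IsChartAt φ x) : ∀ᶠ y in 𝓝 x, X.IsChartAt φ y := by
  filter_upwards [φ.open_source.mem_nhds h.2] with y hy using ⟨h.1, hy⟩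

theorem SmoothNear.eventually {f : X → ℝ} (h : X.SmoothNear f x) :
    ∀ᶠ y in 𝓝 x, X.SmoothNear f y := eventually_eventually_nhds.2 h

theorem SmoothNear.congr {f g : X → ℝ} (h : X.SmoothNear f x) (hg : g =ᶠ[𝓝 x] f) :
    X.SmoothNear g x :=
  (h.and hg.eventuallyEq_nhds).mono fun _ hy => hy.1.congr_of_eventuallyEq hy.2

theorem SmoothNear.add {f g : X → ℝ} (hf : X.SmoothNear f x) (hg : X.SmoothNear g x) :
    X.SmoothNear (fun y => f y + g y) x := (hf.and hg).mono fun _ h => h.1.add h.2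

theorem SmoothNear.sub {f g : X → ℝ} (hf : X.SmoothNear f x) (hg : X.SmoothNear g x) :
    X.SmoothNear (fun y => f y - g y) x := (hf.and hg).mono fun _ h => h.1.sub h.2

theorem SmoothNear.mul {f g : X → ℝ} (hf : X.SmoothNear f x) (hg : X.SmoothNear g x) :
    X.SmoothNear (fun y => f y * g y) x := (hf.and hg).mono fun _ h => h.1.mul h.2

theorem smoothNear_const (c : ℝ) : X.SmoothNear (fun _ => c) x :=
  Eventually.of_forall fun _ => contMDiffAt_const

theorem SmoothNear.sum {ι : Type*} {s : Finset ι} {f : ι → X → ℝ}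
    (hf : ∀ i ∈ s, X.SmoothNear (f i) x) : X.SmoothNear (fun y => ∑ i ∈ s, f i y) x :=
  ((Filter.eventually_all_finset s).2 hf).mono fun _ h => contMDiffAt_finsetSum h

theorem SmoothNear.prod {ι : Type*} {s : Finset ι} {f : ι → X → ℝ}
    (hf : ∀ i ∈ s, X.SmoothNear (f i) x) : X.SmoothNear (fun y => ∏ i ∈ s, f i y) x :=
  ((Filter.eventually_all_finset s).2 hf).mono fun _ h => contMDiffAt_finsetProd h

theorem SmoothNear.pow {f : X → ℝ} (hf : X.SmoothNear f x) (k : ℕ) :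
    X.SmoothNear (fun y => f y ^ k) x := hf.mono fun _ h => h.pow k

theorem SmoothNear.exp {f : X → ℝ} (hf : X.SmoothNear f x) :
    X.SmoothNear (fun y => Real.exp (f y)) x :=
  hf.mono fun _ h => Real.contDiff_exp.contMDiff.contMDiffAt.comp _ h

theorem SmoothNear.inv {f : X → ℝ} (hf : X.SmoothNear f x) (h0 : f x ≠ 0) :
    X.SmoothNear (fun y => (f y)⁻¹) x :=
  (hf.and (hf.self_of_nhds.continuousAt.eventually_ne h0)).mono fun y h =>
    (contDiffAt_inv ℝ h.2).contMDiffAt.comp y h.1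

theorem SmoothNear.continuousAt {f : X → ℝ} (hf : X.SmoothNear f x) : ContinuousAt f x :=
  hf.self_of_nhds.continuousAt

theorem contMDiffAt_coord (hφ : X.IsChartAt φ x) :
    ContMDiffAt (𝓒 n) 𝓘(ℝ, EuclideanSpace ℝ (Fin n)) ∞ (fun y => (φ y).1) x :=
  φ.contMDiffAt_extend hφ.1 hφ.2

theorem smoothNear_coord (hφ : X.IsChartAt φ x) (j : Fin n) :
    X.SmoothNear (fun y => (φ y).1 j) x :=
  hφ.eventually.mono fun y hy =>
    (EuclideanSpace.proj (𝕜 := ℝ) j).contDiff.contMDiff.contMDiffAt.comp y (contMDiffAt_coord hy)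

/-- Properties that hold near `x` hold near the coordinates of `x`. -/
theorem exists_ball_of_eventually (hφ : X.IsChartAt φ x) {p : X → Prop} (hp : ∀ᶠ y in 𝓝 x, p y) :
    ∃ r > 0, ∀ z ∈ Metric.ball (φ x).1 r ∩ quadrant n,
      invChart φ z ∈ φ.source ∧ (φ (invChart φ z)).1 = z ∧ p (invChart φ z) := by
  have hT : (φ.extend (𝓒 n)).target ∈ 𝓝[quadrant n] (φ x).1 := by
    rw [← range_model]; exact φ.extend_target_mem_nhdsWithin (I := 𝓒 n) hφ.2
  have hc : ContinuousAt (invChart φ) (φ x).1 := φ.continuousAt_extend_symm (I := 𝓒 n) hφ.2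
  have hp' : ∀ᶠ z in 𝓝 (φ x).1, p (invChart φ z) := by
    apply hc.eventually
    rwa [invChart_coord hφ.2]
  obtain ⟨r, hr, h⟩ := Metric.mem_nhdsWithin_iff.1 (inter_mem hT (mem_nhdsWithin_of_mem_nhds hp'))
  refine ⟨r, hr, fun z hz => ⟨?_, ?_, (h hz).2⟩⟩
  · have := (φ.extend (𝓒 n)).map_target (h hz).1
    rwa [φ.extend_source] at this
  · exact (φ.extend (𝓒 n)).right_inv (h hz).1

/-- A function that is smooth near `x` is, in coordinates, smooth up to the boundary of a relative
ball in the quadrant. -/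
theorem contDiffOn_comp_invChart (hφ : X.IsChartAt φ x) {f : X → ℝ} (hf : X.SmoothNear f x) :
    ∃ r > 0, ContDiffOn ℝ ∞ (f ∘ invChart φ) (Metric.ball (φ x).1 r ∩ quadrant n) := by
  obtain ⟨r, hr, h⟩ := exists_ball_of_eventually hφ hf
  refine ⟨r, hr, fun z hz => ?_⟩
  obtain ⟨h1, h2, h3⟩ := h z hz
  rw [← contMDiffWithinAt_iff_contDiffWithinAt]
  refine ContMDiffAt.comp_contMDiffWithinAt z h3 ?_
  have hz' : z ∈ (𝓒 n) '' φ.target := ⟨φ (invChart φ z), φ.map_source h1, h2⟩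
  refine (contMDiffOn_extend_symm hφ.1 z hz').mono_of_mem_nhdsWithin ?_
  have := φ.extend_target_mem_nhdsWithin (I := 𝓒 n) h1
  rw [range_model] at this
  simp only [OpenPartialHomeomorph.extend_coe, Function.comp] at this
  refine nhdsWithin_mono _ inter_subset_right ?_
  have e : (𝓒 n) (φ (invChart φ z)) = z := h2
  rw [e, φ.extend_target'] at this
  exact this

theorem smoothNear_comp_coord (hφ : X.IsChartAt φ x) {k : EuclideanSpace ℝ (Fin n) → ℝ} {r : ℝ}
    (hr : 0 < r) (hk : ContDiffOn ℝ ∞ k (Metric.ball (φ x).1 r ∩ quadrant n)) :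
    X.SmoothNear (fun y => k (φ y).1) x := by
  have : ∀ᶠ y in 𝓝 x, (φ y).1 ∈ Metric.ball (φ x).1 r :=
    (contMDiffAt_coord hφ).continuousAt.eventually (Metric.ball_mem_nhds _ hr)
  filter_upwards [hφ.eventually, this.eventually_nhds] with y hy hyr
  have h1 := (hk _ ⟨hyr.self_of_nhds, coord_mem_quadrant y⟩).contMDiffWithinAt
  have hm : (fun w => (φ w).1) ⁻¹' (Metric.ball (φ x).1 r ∩ quadrant n) ∈ 𝓝 y := by
    filter_upwards [hyr] with w hw using ⟨hw, coord_mem_quadrant w⟩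
  exact (h1.comp y (contMDiffAt_coord hy).contMDiffWithinAt (mapsTo_preimage _ _)).contMDiffAt hm

/-- The partial derivative `∂f/∂φⱼ`, one-sided where `φⱼ` vanishes. -/
def chartDeriv {X : CornerManifold.{u} n} (φ : OpenPartialHomeomorph X (EuclideanQuadrant n))
    (j : Fin n) (f : X → ℝ) (y : X) : ℝ :=
  fderivWithin ℝ (f ∘ invChart φ) (quadrant n) (φ y).1 (EuclideanSpace.single j 1)

theorem ball_inter_quadrant_mem (z : EuclideanSpace ℝ (Fin n)) {r : ℝ} (hr : 0 < r) :
    Metric.ball z r ∩ quadrant n ∈ 𝓝[quadrant n] z :=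
  inter_mem (mem_nhdsWithin_of_mem_nhds (Metric.ball_mem_nhds _ hr)) self_mem_nhdsWithin

theorem hasFDerivWithinAt_comp_invChart (hφ : X.IsChartAt φ x) {f : X → ℝ}
    (hf : X.SmoothNear f x) : HasFDerivWithinAt (f ∘ invChart φ)
      (fderivWithin ℝ (f ∘ invChart φ) (quadrant n) (φ x).1) (quadrant n) (φ x).1 := by
  obtain ⟨r, hr, h⟩ := contDiffOn_comp_invChart hφ hf
  exact ((h.differentiableOn (by simp) _ ⟨Metric.mem_ball_self hr, coord_mem_quadrant x⟩
    ).mono_of_mem_nhdsWithin (ball_inter_quadrant_mem _ hr)).hasFDerivWithinAt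

theorem eventuallyEq_comp_invChart (hφ : X.IsChartAt φ x) {f g : X → ℝ} (h : f =ᶠ[𝓝 x] g) :
    f ∘ invChart φ =ᶠ[𝓝[quadrant n] (φ x).1] g ∘ invChart φ := by
  obtain ⟨r, hr, h'⟩ := exists_ball_of_eventually hφ h
  filter_upwards [ball_inter_quadrant_mem (φ x).1 hr] with z hz using (h' z hz).2.2

theorem chartDeriv_congr (hφ : X.IsChartAt φ x) {f g : X → ℝ} (h : f =ᶠ[𝓝 x] g) (j : Fin n) :
    chartDeriv φ j f x = chartDeriv φ j g x := by
  unfold chartDeriv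
  rw [(eventuallyEq_comp_invChart hφ h).fderivWithin_eq_of_mem (coord_mem_quadrant x)]

theorem chartDeriv_add (hφ : X.IsChartAt φ x) {f g : X → ℝ} (hf : X.SmoothNear f x)
    (hg : X.SmoothNear g x) (j : Fin n) :
    chartDeriv φ j (fun y => f y + g y) x = chartDeriv φ j f x + chartDeriv φ j g x := by
  have := ((hasFDerivWithinAt_comp_invChart hφ hf).add
    (hasFDerivWithinAt_comp_invChart hφ hg)).fderivWithin
    (uniqueDiffOn_quadrant _ (coord_mem_quadrant x))
  exact congrArg (· (EuclideanSpace.single j 1)) this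

theorem chartDeriv_mul (hφ : X.IsChartAt φ x) {f g : X → ℝ} (hf : X.SmoothNear f x)
    (hg : X.SmoothNear g x) (j : Fin n) :
    chartDeriv φ j (fun y => f y * g y) x =
      f x * chartDeriv φ j g x + g x * chartDeriv φ j f x := by
  have := ((hasFDerivWithinAt_comp_invChart hφ hf).mul
    (hasFDerivWithinAt_comp_invChart hφ hg)).fderivWithin
    (uniqueDiffOn_quadrant _ (coord_mem_quadrant x))
  have := congrArg (· (EuclideanSpace.single j 1)) this
  simp only [Function.comp, invChart_coord hφ.2] at this
  exact this

theorem chartDeriv_const (c : ℝ) (j : Fin n) : chartDeriv φ j (fun _ => c) x = 0 := by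
  have : (fun _ => c : X → ℝ) ∘ invChart φ = fun _ => c := rfl
  simp [chartDeriv, this]

theorem chartDeriv_exp (hφ : X.IsChartAt φ x) {f : X → ℝ} (hf : X.SmoothNear f x) (j : Fin n) :
    chartDeriv φ j (fun y => Real.exp (f y)) x = Real.exp (f x) * chartDeriv φ j f x := by
  have := ((hasFDerivWithinAt_comp_invChart hφ hf).exp).fderivWithin
    (uniqueDiffOn_quadrant _ (coord_mem_quadrant x))
  have := congrArg (· (EuclideanSpace.single j 1)) this
  simp only [Function.comp, invChart_coord hφ.2] at this
  exact this

theorem chartDeriv_sum {ι : Type*} {s : Finset ι} (hφ : X.IsChartAt φ x) {f : ι → X → ℝ}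
    (hf : ∀ i ∈ s, X.SmoothNear (f i) x) (j : Fin n) :
    chartDeriv φ j (fun y => ∑ i ∈ s, f i y) x = ∑ i ∈ s, chartDeriv φ j (f i) x := by
  classical
  induction s using Finset.induction_on with
  | empty => simpa using chartDeriv_const 0 j
  | insert a s ha ih =>
    simp only [Finset.sum_insert ha]
    rw [chartDeriv_add hφ (hf a (by simp)) (SmoothNear.sum fun i hi => hf i (by simp [hi])),
      ih fun i hi => hf i (by simp [hi])]

theorem chartDeriv_coord (hφ : X.IsChartAt φ x) (j k : Fin n) :
    chartDeriv φ j (fun y => (φ y).1 k) x = if k = j then 1 else 0 := by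
  have h1 : HasFDerivWithinAt (fun z : EuclideanSpace ℝ (Fin n) => z k)
      (EuclideanSpace.proj (𝕜 := ℝ) k) (quadrant n) (φ x).1 :=
    (EuclideanSpace.proj (𝕜 := ℝ) k).hasFDerivWithinAt
  obtain ⟨r, hr, h'⟩ := exists_ball_of_eventually hφ (p := fun _ => True) (by simp)
  have h2 : (fun y => (φ y).1 k) ∘ invChart φ =ᶠ[𝓝[quadrant n] (φ x).1] fun z => z k := by
    filter_upwards [ball_inter_quadrant_mem (φ x).1 hr] with z hz
    simp [(h' z hz).2.1]
  unfold chartDeriv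
  rw [h2.fderivWithin_eq_of_mem (coord_mem_quadrant x),
    h1.fderivWithin (uniqueDiffOn_quadrant _ (coord_mem_quadrant x))]
  simp

theorem smoothNear_chartDeriv (hφ : X.IsChartAt φ x) {f : X → ℝ} (hf : X.SmoothNear f x)
    (j : Fin n) : X.SmoothNear (chartDeriv φ j f) x := by
  obtain ⟨r, hr, h⟩ := contDiffOn_comp_invChart hφ hf
  have h1 := (h.fderivWithin (uniqueDiffOn_ball_inter_quadrant _ _) (m := ∞) (by simp)).clm_apply
    (contDiffOn_const (c := EuclideanSpace.single j (1 : ℝ)))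
  refine smoothNear_comp_coord hφ hr (k := fun z => fderivWithin ℝ (f ∘ invChart φ) (quadrant n) z
    (EuclideanSpace.single j 1)) (h1.congr fun z hz => ?_)
  rw [inter_comm, fderivWithin_inter (Metric.isOpen_ball.mem_nhds hz.1)]

/-- Taylor expansion at `x` to first order, with smooth coefficients. -/
theorem exists_taylor (hφ : X.IsChartAt φ x) {f : X → ℝ} (hf : X.SmoothNear f x) :
    ∃ h : Fin n → X → ℝ, (∀ j, X.SmoothNear (h j) x) ∧ (∀ j, h j x = chartDeriv φ j f x) ∧
      ∀ᶠ y in 𝓝 x, f y = f x + ∑ j, ((φ y).1 j - (φ x).1 j) * h j y := by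
  obtain ⟨r, hr, hk⟩ := contDiffOn_comp_invChart hφ hf
  obtain ⟨H, hH, hHe⟩ := exists_hadamard_of_convex (convex_ball_inter_quadrant _ _)
    (uniqueDiffOn_ball_inter_quadrant _ _) hk (P := fun _ => (φ x).1) contDiff_const
    (fun _ _ => ⟨Metric.mem_ball_self hr, coord_mem_quadrant x⟩)
  let h : Fin n → X → ℝ := fun j y => H (φ y).1 (EuclideanSpace.single j 1)
  have hs : ∀ j, X.SmoothNear (h j) x := fun j =>
    smoothNear_comp_coord hφ hr (hH.clm_apply contDiffOn_const)
  have he : ∀ᶠ y in 𝓝 x, f y = f x + ∑ j, ((φ y).1 j - (φ x).1 j) * h j y := by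
    have hb : ∀ᶠ y in 𝓝 x, (φ y).1 ∈ Metric.ball (φ x).1 r :=
      (contMDiffAt_coord hφ).continuousAt.eventually (Metric.ball_mem_nhds _ hr)
    filter_upwards [hb, hφ.eventually] with y hy hy'
    have := hHe _ ⟨hy, coord_mem_quadrant y⟩
    simp only [Function.comp, invChart_coord hφ.2, invChart_coord hy'.2] at this
    rw [← sub_eq_iff_eq_add', this]
    conv_lhs => rw [← (EuclideanSpace.basisFun (Fin n) ℝ).sum_repr ((φ y).1 - (φ x).1)]
    simp [h, map_sum]
  refine ⟨h, hs, fun j => ?_, he⟩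
  rw [chartDeriv_congr hφ he, chartDeriv_add hφ (smoothNear_const _) (SmoothNear.sum fun i _ =>
    (((smoothNear_coord hφ i).sub (smoothNear_const _)).mul (hs i))), chartDeriv_const,
    chartDeriv_sum hφ fun i _ => ((smoothNear_coord hφ i).sub (smoothNear_const _)).mul (hs i)]
  have : ∀ i, chartDeriv φ j (fun y => ((φ y).1 i - (φ x).1 i) * h i y) x =
      if i = j then h i x else 0 := by
    intro i
    rw [chartDeriv_mul hφ ((smoothNear_coord hφ i).sub (smoothNear_const _)) (hs i)]
    have e : (fun y => (φ y).1 i - (φ x).1 i) = fun y => (φ y).1 i + (-(φ x).1 i) := by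
      ext; ring
    rw [e, chartDeriv_add hφ (smoothNear_coord hφ i) (smoothNear_const _), chartDeriv_const,
      chartDeriv_coord hφ]
    simp
  simp [this]

/-- A smooth function that vanishes on the boundary hypersurface `φⱼ = 0` is divisible by `φⱼ`. -/
theorem exists_eq_coord_mul (hφ : X.IsChartAt φ x) {f : X → ℝ} (hf : X.SmoothNear f x) {j : Fin n}
    (hj : (φ x).1 j = 0) (h0 : ∀ᶠ y in 𝓝 x, (φ y).1 j = 0 → f y = 0) :
    ∃ u : X → ℝ, X.SmoothNear u x ∧ u x = chartDeriv φ j f x ∧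
      ∀ᶠ y in 𝓝 x, f y = (φ y).1 j * u y := by
  obtain ⟨r₁, hr₁, hk⟩ := contDiffOn_comp_invChart hφ hf
  obtain ⟨r₂, hr₂, hz⟩ := exists_ball_of_eventually hφ h0
  obtain ⟨r, hr, hrr₁, hrr₂⟩ : ∃ r > 0, r ≤ r₁ ∧ r ≤ r₂ :=
    ⟨min r₁ r₂, lt_min hr₁ hr₂, min_le_left _ _, min_le_right _ _⟩
  -- `P` is the projection along the `j`-th axis; it preserves balls around `φ x` as `φⱼ(x) = 0`.
  let P : EuclideanSpace ℝ (Fin n) → EuclideanSpace ℝ (Fin n) :=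
    fun z => z - z j • EuclideanSpace.single j 1
  have hPi : ∀ z i, P z i = if i = j then 0 else z i := by
    intro z i
    by_cases h : i = j
    · subst h; simp [P]
    · simp [P, h]
  have hP : ContDiff ℝ ∞ P :=
    contDiff_id.sub ((EuclideanSpace.proj (𝕜 := ℝ) j).contDiff.smul contDiff_const)
  have hPs : MapsTo P (Metric.ball (φ x).1 r ∩ quadrant n)
      (Metric.ball (φ x).1 r ∩ quadrant n) := by
    rintro z ⟨hz1, hz2⟩
    refine ⟨?_, fun i => ?_⟩
    · rw [Metric.mem_ball] at hz1 ⊢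
      refine lt_of_le_of_lt ?_ hz1
      rw [EuclideanSpace.dist_eq, EuclideanSpace.dist_eq]
      refine Real.sqrt_le_sqrt (Finset.sum_le_sum fun i _ => ?_)
      rw [hPi]
      split_ifs with h
      · subst h; rw [hj]; simp [dist_self]; positivity
      · rfl
    · rw [hPi]; split_ifs
      · rfl
      · exact hz2 i
  obtain ⟨H, hH, hHe⟩ := exists_hadamard_of_convex (convex_ball_inter_quadrant _ _)
    (uniqueDiffOn_ball_inter_quadrant _ _)
    (hk.mono (inter_subset_inter_left _ (Metric.ball_subset_ball hrr₁))) hP hPs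
  let u : X → ℝ := fun y => H (φ y).1 (EuclideanSpace.single j 1)
  have hu : X.SmoothNear u x := smoothNear_comp_coord hφ hr (hH.clm_apply contDiffOn_const)
  have he : ∀ᶠ y in 𝓝 x, f y = (φ y).1 j * u y := by
    have hb : ∀ᶠ y in 𝓝 x, (φ y).1 ∈ Metric.ball (φ x).1 r :=
      (contMDiffAt_coord hφ).continuousAt.eventually (Metric.ball_mem_nhds _ hr)
    filter_upwards [hb, hφ.eventually] with y hy hy'
    have h1 := hHe _ ⟨hy, coord_mem_quadrant y⟩
    have h2 := hPs ⟨hy, coord_mem_quadrant y⟩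
    have h3 := hz _ ⟨Metric.ball_subset_ball hrr₂ h2.1, h2.2⟩
    have h4 : f (invChart φ (P (φ y).1)) = 0 := h3.2.2 (by rw [h3.2.1, hPi]; simp)
    simp only [Function.comp, invChart_coord hy'.2, h4] at h1
    rw [sub_zero] at h1
    rw [h1]
    simp [P, u]
  refine ⟨u, hu, ?_, he⟩
  rw [chartDeriv_congr hφ he, chartDeriv_mul hφ (smoothNear_coord hφ j) hu, chartDeriv_coord hφ, hj]
  simp

/-- At a zero of a non-negative function the derivatives in the directions that point into the
manifold are non-negative, and those along coordinates that do not vanish are zero. -/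
theorem chartDeriv_nonneg (hφ : X.IsChartAt φ x) {f : X → ℝ} (hf : X.SmoothNear f x)
    (h0 : ∀ᶠ y in 𝓝 x, 0 ≤ f y) (hx : f x = 0) (j : Fin n) :
    0 ≤ chartDeriv φ j f x ∧
      (0 < (φ x).1 j → chartDeriv φ j f x = 0) := by
  have hmin : IsLocalMinOn (f ∘ invChart φ) (quadrant n) (φ x).1 := by
    obtain ⟨r, hr, h'⟩ := exists_ball_of_eventually hφ h0
    filter_upwards [ball_inter_quadrant_mem (φ x).1 hr] with z hz
    simpa [Function.comp, invChart_coord hφ.2, hx] using (h' z hz).2.2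
  have hd := hasFDerivWithinAt_comp_invChart hφ hf
  refine ⟨?_, fun hj => ?_⟩
  · refine hmin.hasFDerivWithinAt_nonneg hd (mem_posTangentConeAt_of_segment_subset ?_)
    refine convex_quadrant.segment_subset (coord_mem_quadrant x) fun i => ?_
    have := coord_mem_quadrant (φ := φ) x i
    by_cases h : i = j
    · subst h; simp; linarith
    · simpa [h] using this
  · have h1 : EuclideanSpace.single j (1 : ℝ) ∈ posTangentConeAt (quadrant n) (φ x).1 := by
      refine mem_posTangentConeAt_of_segment_subset ?_
      refine convex_quadrant.segment_subset (coord_mem_quadrant x) fun i => ?_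
      have := coord_mem_quadrant (φ := φ) x i
      by_cases h : i = j
      · subst h; simp; linarith
      · simpa [h] using this
    have h2 : -((φ x).1 j • EuclideanSpace.single j (1 : ℝ)) ∈
        posTangentConeAt (quadrant n) (φ x).1 := by
      refine mem_posTangentConeAt_of_segment_subset ?_
      refine convex_quadrant.segment_subset (coord_mem_quadrant x) fun i => ?_
      have := coord_mem_quadrant (φ := φ) x i
      by_cases h : i = j
      · subst h; simp
      · simpa [h] using this
    have h3 := hmin.hasFDerivWithinAt_nonneg hd h1
    have h4 := hmin.hasFDerivWithinAt_nonneg hd h2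
    rw [map_neg, map_smul, smul_eq_mul] at h4
    unfold chartDeriv
    nlinarith

theorem frequently_coord_eq_add_smul (hφ : X.IsChartAt φ x) {v : EuclideanSpace ℝ (Fin n)}
    (hv : v ∈ quadrant n) :
    ∃ᶠ y in 𝓝 x, ∃ t : ℝ, 0 < t ∧ (φ y).1 = (φ x).1 + t • v := by
  intro hcon
  obtain ⟨r, hr, h⟩ := exists_ball_of_eventually hφ hcon
  have hc : Continuous fun t : ℝ => (φ x).1 + t • v := by fun_prop
  have : ∀ᶠ t : ℝ in 𝓝[>] 0, (φ x).1 + t • v ∈ Metric.ball (φ x).1 r := by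
    refine mem_nhdsWithin_of_mem_nhds (hc.continuousAt.eventually (Metric.isOpen_ball.mem_nhds ?_))
    simpa using hr
  obtain ⟨t, ht, ht0⟩ := (this.and self_mem_nhdsWithin).exists
  have ht0 : (0 : ℝ) < t := ht0
  have h3 := h _ ⟨ht, fun j => add_nonneg (coord_mem_quadrant x j) (mul_nonneg ht0.le (hv j))⟩
  exact h3.2.2 ⟨t, ht0, h3.2.1⟩

/-- The interior of the manifold is dense. -/
theorem frequently_coord_pos (hφ : X.IsChartAt φ x) : ∃ᶠ y in 𝓝 x, ∀ j, 0 < (φ y).1 j := by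
  refine (frequently_coord_eq_add_smul hφ (v := WithLp.toLp 2 fun _ => 1)
    (fun _ => zero_le_one)).mono ?_
  rintro y ⟨t, ht, h⟩ j
  have := coord_mem_quadrant (φ := φ) x j
  rw [h]
  simp; linarith

end CornerManifold

namespace CornerManifold
variable {n m l : ℕ}

variable {X : CornerManifold.{u} n} {φ χ : OpenPartialHomeomorph X (EuclideanQuadrant n)} {x : X}

/-! ### Change of coordinates at the boundary -/

/-- A boundary coordinate has non-zero differential, so some `∂χᵢ/∂φⱼ` is non-zero; as `χᵢ` is
non-negative this makes `φⱼ` vanish wherever `χᵢ` does. -/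
theorem exists_chartDeriv_coord_ne_zero (hφ : X.IsChartAt φ x) (hχ : X.IsChartAt χ x) {i : Fin n}
    (hi : (χ x).1 i = 0) : ∃ j, (φ x).1 j = 0 ∧ chartDeriv φ j (fun y => (χ y).1 i) x ≠ 0 ∧
      ∀ᶠ y in 𝓝 x, (χ y).1 i = 0 → (φ y).1 j = 0 := by
  have hs := smoothNear_coord hχ i
  have key : ∀ y, X.IsChartAt φ y → X.IsChartAt χ y → (χ y).1 i = 0 → ∀ j,
      chartDeriv φ j (fun y => (χ y).1 i) y ≠ 0 → (φ y).1 j = 0 := by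
    intro y hφy hχy hy j hj
    by_contra h
    exact hj ((chartDeriv_nonneg hφy (smoothNear_coord hχy i)
      (Eventually.of_forall fun w => coord_mem_quadrant w i) hy j).2
      (lt_of_le_of_ne (coord_mem_quadrant y j) (Ne.symm h)))
  obtain ⟨j, hj⟩ : ∃ j, chartDeriv φ j (fun y => (χ y).1 i) x ≠ 0 := by
    -- Otherwise `χᵢ` would vanish to second order at `x`, against `∂χᵢ/∂χᵢ = 1`.
    by_contra! hcon
    obtain ⟨h, hh, hhx, he⟩ := exists_taylor hφ hs
    have hsm : ∀ j, X.SmoothNear (fun y => (φ y).1 j - (φ x).1 j) x := fun j =>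
      (smoothNear_coord hφ j).sub (smoothNear_const _)
    have h1 := chartDeriv_coord hχ i i
    rw [chartDeriv_congr hχ he, chartDeriv_add hχ (smoothNear_const _)
      (SmoothNear.sum fun j _ => (hsm j).mul (hh j)), chartDeriv_const,
      chartDeriv_sum hχ fun j _ => (hsm j).mul (hh j)] at h1
    have h2 : ∀ j, chartDeriv χ i (fun y => ((φ y).1 j - (φ x).1 j) * h j y) x = 0 := by
      intro j
      rw [chartDeriv_mul hχ (hsm j) (hh j), hhx, hcon]
      simp
    simp [h2] at h1
  refine ⟨j, key x hφ hχ hi j hj, hj, ?_⟩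
  filter_upwards [(smoothNear_chartDeriv hφ hs j).continuousAt.eventually_ne hj, hφ.eventually,
    hχ.eventually] with y h1 h2 h3 h4 using key y h2 h3 h4 j h1

/-- Up to positive smooth factors, the boundary coordinates of two coordinate systems at a point are
permutations of each other. -/
theorem exists_coord_eq_coord_mul (hφ : X.IsChartAt φ x) (hχ : X.IsChartAt χ x) {i : Fin n}
    (hi : (χ x).1 i = 0) : ∃ j, ∃ u : X → ℝ, X.SmoothNear u x ∧ 0 < u x ∧
      ∀ᶠ y in 𝓝 x, (χ y).1 i = (φ y).1 j * u y := by
  obtain ⟨j, hj, hd, h1⟩ := exists_chartDeriv_coord_ne_zero hφ hχ hi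
  obtain ⟨i', hi', -, h2⟩ := exists_chartDeriv_coord_ne_zero hχ hφ hj
  -- Near `x`, `χᵢ = 0` implies `φⱼ = 0`, which implies `χᵢ' = 0`; so the two hypersurfaces agree.
  have hii' : i' = i := by
    by_contra hne
    have hv : EuclideanSpace.single i' (1 : ℝ) ∈ quadrant n := fun k => by
      by_cases h : k = i'
      · subst h; simp
      · simp [h]
    obtain ⟨y, ⟨t, ht, hy⟩, h3, h4⟩ :=
      ((frequently_coord_eq_add_smul hχ hv).and_eventually (h1.and h2)).exists
    have h5 := h4 (h3 (by rw [hy]; simp [hi, Ne.symm hne]))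
    rw [hy] at h5
    simp [hi', ht.ne'] at h5
  subst hii'
  obtain ⟨w, hw, hwx, he⟩ := exists_eq_coord_mul hφ (smoothNear_coord hχ i') hj h2
  exact ⟨j, w, hw, hwx ▸ lt_of_le_of_ne (chartDeriv_nonneg hφ (smoothNear_coord hχ i')
    (Eventually.of_forall fun w => coord_mem_quadrant w i') hi j).1 (Ne.symm hd), he⟩

/-! ### Interior b-functions -/

/-- Near `x`, the function `g` is `v · ∏ⱼ φⱼ ^ aⱼ` with `v` smooth and positive. -/
def HasBForm {X : CornerManifold.{u} n} (φ : OpenPartialHomeomorph X (EuclideanQuadrant n)) (x : X)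
    (g : X → ℝ) (a : Fin n → ℕ) (v : X → ℝ) : Prop :=
  X.SmoothNear v x ∧ 0 < v x ∧ ∀ᶠ y in 𝓝 x, g y = v y * ∏ j, (φ y).1 j ^ a j

variable {g h : X → ℝ} {a b : Fin n → ℕ} {v w : X → ℝ}

theorem HasBForm.isBFun (H : HasBForm φ x g a v) (hφ : X.IsChartAt φ x) : X.IsBFun g x :=
  ⟨φ, hφ, a, v, H⟩

theorem HasBForm.congr (H : HasBForm φ x g a v) (e : g =ᶠ[𝓝 x] h) : HasBForm φ x h a v :=
  ⟨H.1, H.2.1, (H.2.2.and e).mono fun _ hy => hy.2 ▸ hy.1⟩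

theorem HasBForm.eventually (H : HasBForm φ x g a v) : ∀ᶠ y in 𝓝 x, HasBForm φ y g a v := by
  filter_upwards [H.1.eventually, H.1.continuousAt.eventually (lt_mem_nhds H.2.1),
    H.2.2.eventually_nhds] with y h1 h2 h3 using ⟨h1, h2, h3⟩

theorem HasBForm.mul (H : HasBForm φ x g a v) (K : HasBForm φ x h b w) :
    HasBForm φ x (fun y => g y * h y) (a + b) (fun y => v y * w y) := by
  refine ⟨H.1.mul K.1, mul_pos H.2.1 K.2.1, ?_⟩
  filter_upwards [H.2.2, K.2.2] with y h1 h2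
  simp only [h1, h2, Pi.add_apply, pow_add, Finset.prod_mul_distrib]
  ring

theorem hasBForm_of_pos (hv : X.SmoothNear v x) (h0 : 0 < v x) : HasBForm φ x v 0 v :=
  ⟨hv, h0, by simp⟩

theorem hasBForm_coord (j : Fin n) :
    HasBForm φ x (fun y => (φ y).1 j) (Pi.single j 1) (fun _ => 1) := by
  refine ⟨smoothNear_const 1, one_pos, Eventually.of_forall fun y => ?_⟩
  rw [Finset.prod_eq_single j (fun k _ hk => by simp [hk]) (by simp)]
  simp

theorem HasBForm.pow (H : HasBForm φ x g a v) (k : ℕ) :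
    HasBForm φ x (fun y => g y ^ k) (k • a) (fun y => v y ^ k) := by
  refine ⟨H.1.pow k, pow_pos H.2.1 k, H.2.2.mono fun y h1 => ?_⟩
  simp only [h1, mul_pow, ← Finset.prod_pow, ← pow_mul, Pi.smul_apply, smul_eq_mul, mul_comm k]

theorem exists_hasBForm_prod {ι : Type*} {s : Finset ι} {g : ι → X → ℝ}
    (H : ∀ i ∈ s, ∃ a v, HasBForm φ x (g i) a v) :
    ∃ a v, HasBForm φ x (fun y => ∏ i ∈ s, g i y) a v := by
  classical
  induction s using Finset.induction_on with
  | empty =>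
    simp only [Finset.prod_empty]
    exact ⟨0, _, hasBForm_of_pos (smoothNear_const 1) one_pos⟩
  | insert i s hi ih =>
    obtain ⟨a, v, h1⟩ := H i (by simp)
    obtain ⟨b, w, h2⟩ := ih fun k hk => H k (by simp [hk])
    simp only [Finset.prod_insert hi]
    exact ⟨_, _, h1.mul h2⟩

/-- An interior b-function has the defining form in every coordinate system. -/
theorem IsBFun.exists_hasBForm (hg : X.IsBFun g x) (hφ : X.IsChartAt φ x) :
    ∃ a v, HasBForm φ x g a v := by
  obtain ⟨χ, hχ, a, v, hv, h0, he⟩ := hg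
  have h1 : ∀ i ∈ (Finset.univ : Finset (Fin n)),
      ∃ b w, HasBForm φ x (fun y => (χ y).1 i ^ a i) b w := by
    intro i _
    by_cases hi : (χ x).1 i = 0
    · obtain ⟨j, w, hw, hw0, hj⟩ := exists_coord_eq_coord_mul hφ hχ hi
      have := ((hasBForm_coord (φ := φ) (x := x) j).mul (hasBForm_of_pos hw hw0)).congr
        (EventuallyEq.symm hj)
      exact ⟨_, _, this.pow (a i)⟩
    · have := hasBForm_of_pos (φ := φ) (smoothNear_coord hχ i)
        (lt_of_le_of_ne (coord_mem_quadrant x i) (Ne.symm hi))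
      exact ⟨_, _, this.pow (a i)⟩
  obtain ⟨b, w, h2⟩ := exists_hasBForm_prod h1
  exact ⟨_, _, ((hasBForm_of_pos (φ := φ) hv h0).mul h2).congr (EventuallyEq.symm he)⟩

theorem exists_isChartAt (X : CornerManifold.{u} n) (x : X) : ∃ φ, X.IsChartAt φ x :=
  ⟨chartAt _ x, IsManifold.chart_mem_maximalAtlas x, mem_chart_source _ x⟩

theorem IsBFun.congr (hg : X.IsBFun g x) (e : g =ᶠ[𝓝 x] h) : X.IsBFun h x := by
  obtain ⟨φ, hφ⟩ := exists_isChartAt X x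
  obtain ⟨a, v, H⟩ := hg.exists_hasBForm hφ
  exact (H.congr e).isBFun hφ

theorem IsBFun.eventually (hg : X.IsBFun g x) : ∀ᶠ y in 𝓝 x, X.IsBFun g y := by
  obtain ⟨φ, hφ⟩ := exists_isChartAt X x
  obtain ⟨a, v, H⟩ := hg.exists_hasBForm hφ
  exact (H.eventually.and hφ.eventually).mono fun y hy => hy.1.isBFun hy.2

theorem IsBFun.mul (hg : X.IsBFun g x) (hh : X.IsBFun h x) : X.IsBFun (fun y => g y * h y) x := by
  obtain ⟨φ, hφ⟩ := exists_isChartAt X x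
  obtain ⟨a, v, H⟩ := hg.exists_hasBForm hφ
  obtain ⟨b, w, K⟩ := hh.exists_hasBForm hφ
  exact (H.mul K).isBFun hφ

theorem isBFun_of_pos (hv : X.SmoothNear v x) (h0 : 0 < v x) : X.IsBFun v x := by
  obtain ⟨φ, hφ⟩ := exists_isChartAt X x
  exact (hasBForm_of_pos hv h0).isBFun hφ

theorem isBFun_exp (hv : X.SmoothNear v x) : X.IsBFun (fun y => Real.exp (v y)) x :=
  isBFun_of_pos hv.exp (Real.exp_pos _)

theorem isBFun_coord (hφ : X.IsChartAt φ x) (j : Fin n) : X.IsBFun (fun y => (φ y).1 j) x :=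
  (hasBForm_coord j).isBFun hφ

theorem IsBFun.pow (hg : X.IsBFun g x) (k : ℕ) : X.IsBFun (fun y => g y ^ k) x := by
  obtain ⟨φ, hφ⟩ := exists_isChartAt X x
  obtain ⟨a, v, H⟩ := hg.exists_hasBForm hφ
  exact (H.pow k).isBFun hφ

theorem IsBFun.prod {ι : Type*} {s : Finset ι} {g : ι → X → ℝ} (H : ∀ i ∈ s, X.IsBFun (g i) x) :
    X.IsBFun (fun y => ∏ i ∈ s, g i y) x := by
  obtain ⟨φ, hφ⟩ := exists_isChartAt X x
  obtain ⟨a, v, H⟩ := exists_hasBForm_prod fun i hi => (H i hi).exists_hasBForm hφ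
  exact H.isBFun hφ

theorem IsBFun.smoothNear (hg : X.IsBFun g x) : X.SmoothNear g x := by
  obtain ⟨φ, hφ⟩ := exists_isChartAt X x
  obtain ⟨a, v, H⟩ := hg.exists_hasBForm hφ
  exact (H.1.mul (SmoothNear.prod fun j _ => (smoothNear_coord hφ j).pow _)).congr H.2.2

/-! ### The logarithmic derivatives `φⱼ ∂/∂φⱼ` -/

/-- The derivative `φⱼ ∂f/∂φⱼ`. -/
def bPartial {X : CornerManifold.{u} n} (φ : OpenPartialHomeomorph X (EuclideanQuadrant n))
    (j : Fin n) (f : X → ℝ) (y : X) : ℝ := (φ y).1 j * chartDeriv φ j f y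

theorem bPartial_congr (hφ : X.IsChartAt φ x) (e : g =ᶠ[𝓝 x] h) (j : Fin n) :
    bPartial φ j g x = bPartial φ j h x := by
  rw [bPartial, bPartial, chartDeriv_congr hφ e]

theorem bPartial_mul (hφ : X.IsChartAt φ x) (hv : X.SmoothNear v x) (hw : X.SmoothNear w x)
    (j : Fin n) :
    bPartial φ j (fun y => v y * w y) x = v x * bPartial φ j w x + w x * bPartial φ j v x := by
  rw [bPartial, chartDeriv_mul hφ hv hw]; simp only [bPartial]; ring

theorem bPartial_const (c : ℝ) (j : Fin n) : bPartial φ j (fun _ => c) x = 0 := by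
  rw [bPartial, chartDeriv_const, mul_zero]

theorem bPartial_exp (hφ : X.IsChartAt φ x) (hv : X.SmoothNear v x) (j : Fin n) :
    bPartial φ j (fun y => Real.exp (v y)) x = Real.exp (v x) * bPartial φ j v x := by
  rw [bPartial, chartDeriv_exp hφ hv]; simp only [bPartial]; ring

theorem smoothNear_bPartial (hφ : X.IsChartAt φ x) (hv : X.SmoothNear v x) (j : Fin n) :
    X.SmoothNear (bPartial φ j v) x := (smoothNear_coord hφ j).mul (smoothNear_chartDeriv hφ hv j)

theorem bPartial_coord_pow (hφ : X.IsChartAt φ x) (j k : Fin n) (m : ℕ) :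
    bPartial φ j (fun y => (φ y).1 k ^ m) x = (if k = j then m else 0) * (φ x).1 k ^ m := by
  induction m with
  | zero => simpa using bPartial_const 1 j
  | succ m ih =>
    simp only [pow_succ]
    rw [bPartial_mul hφ ((smoothNear_coord hφ k).pow m) (smoothNear_coord hφ k), ih, bPartial,
      chartDeriv_coord hφ]
    split_ifs with h
    · subst h; push_cast; ring
    · simp

theorem bPartial_prod_coord_pow (hφ : X.IsChartAt φ x) (j : Fin n) (s : Finset (Fin n)) :
    bPartial φ j (fun y => ∏ k ∈ s, (φ y).1 k ^ a k) x =
      (if j ∈ s then (a j : ℝ) else 0) * ∏ k ∈ s, (φ x).1 k ^ a k := by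
  induction s using Finset.induction_on with
  | empty => simpa using bPartial_const 1 j
  | insert i s hi ih =>
    simp only [Finset.prod_insert hi]
    rw [bPartial_mul hφ ((smoothNear_coord hφ i).pow _)
      (SmoothNear.prod fun k _ => (smoothNear_coord hφ k).pow _), ih, bPartial_coord_pow hφ]
    by_cases h : i = j
    · subst h
      simp only [hi, Finset.mem_insert, true_or, if_true, if_false]
      ring
    · simp only [h, Ne.symm h, Finset.mem_insert, false_or, if_false]
      ring

theorem HasBForm.bPartial_eq (H : HasBForm φ x g a v) (hφ : X.IsChartAt φ x) (j : Fin n) :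
    bPartial φ j g x = g x * (a j + bPartial φ j v x / v x) := by
  rw [bPartial_congr hφ H.2.2, bPartial_mul hφ H.1
    (SmoothNear.prod fun k _ => (smoothNear_coord hφ k).pow _), bPartial_prod_coord_pow hφ,
    H.2.2.self_of_nhds]
  have := H.2.1.ne'
  simp only [Finset.mem_univ, if_true]
  field_simp

theorem HasBForm.smoothNear_coeff (H : HasBForm φ x g a v) (hφ : X.IsChartAt φ x) (j : Fin n) :
    X.SmoothNear (fun y => a j + bPartial φ j v y / v y) x :=
  (smoothNear_const _).add ((smoothNear_bPartial hφ H.1 j).mul (H.1.inv H.2.1.ne'))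

/-- The logarithmic derivative of an interior b-function is determined by the interior, where the
function is positive. -/
theorem HasBForm.coeff_unique (H : HasBForm φ x g a v) (K : HasBForm φ x g b w)
    (hφ : X.IsChartAt φ x) (j : Fin n) :
    a j + bPartial φ j v x / v x = b j + bPartial φ j w x / w x := by
  by_contra hne
  have hev := ((H.smoothNear_coeff hφ j).continuousAt.prodMk
    (K.smoothNear_coeff hφ j).continuousAt).eventually (isOpen_ne_fun continuous_fst
      continuous_snd |>.mem_nhds hne)
  obtain ⟨y, hy, h1, h2, h3, h4⟩ := ((frequently_coord_pos hφ).and_eventually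
    (hev.and (H.eventually.and (K.eventually.and hφ.eventually)))).exists
  have h5 : 0 < g y := by
    rw [h2.2.2.self_of_nhds]
    exact mul_pos h2.2.1 (Finset.prod_pos fun k _ => pow_pos (hy k) _)
  exact h1 (mul_left_cancel₀ h5.ne' ((h2.bPartial_eq h4 j).symm.trans (h3.bPartial_eq h4 j)))

end CornerManifold

namespace CornerManifold
variable {n m l : ℕ}

variable {X : CornerManifold.{u} n} {φ : OpenPartialHomeomorph X (EuclideanQuadrant n)} {x : X}
  {g h v w : X → ℝ} {ξ η : LogFunctional X}

/-! ### The b-tangent space -/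

theorem apply_of_not_isBFun (hξ : ξ ∈ X.bTangentSpace x) (hg : ¬ X.IsBFun g x) : ξ g = 0 :=
  hξ.1 g hg

theorem apply_congr (hξ : ξ ∈ X.bTangentSpace x) (hg : X.IsBFun g x) (e : g =ᶠ[𝓝 x] h) :
    ξ g = ξ h := hξ.2.1 g h hg e

theorem apply_mul (hξ : ξ ∈ X.bTangentSpace x) (hg : X.IsBFun g x) (hh : X.IsBFun h x) :
    ξ (fun y => g y * h y) = ξ g + ξ h := hξ.2.2.1 g h hg hh

theorem bDeriv_const_mul (hξ : ξ ∈ X.bTangentSpace x) (c : ℝ) (hv : X.SmoothNear v x) :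
    bDeriv ξ (fun y => c * v y) = c * bDeriv ξ v := hξ.2.2.2.1 c v hv

theorem bDeriv_mul (hξ : ξ ∈ X.bTangentSpace x) (hv : X.SmoothNear v x) (hw : X.SmoothNear w x) :
    bDeriv ξ (fun y => v y * w y) = v x * bDeriv ξ w + w x * bDeriv ξ v := hξ.2.2.2.2.1 v w hv hw

theorem bDeriv_isBFun (hξ : ξ ∈ X.bTangentSpace x) (hg : X.IsBFun g x) :
    bDeriv ξ g = g x * ξ g := hξ.2.2.2.2.2 g hg

theorem bDeriv_congr (hξ : ξ ∈ X.bTangentSpace x) (hv : X.SmoothNear v x) (e : v =ᶠ[𝓝 x] w) :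
    bDeriv ξ v = bDeriv ξ w :=
  apply_congr (g := fun y => Real.exp (v y)) hξ (isBFun_exp hv) (e.fun_comp Real.exp)

theorem bDeriv_add (hξ : ξ ∈ X.bTangentSpace x) (hv : X.SmoothNear v x) (hw : X.SmoothNear w x) :
    bDeriv ξ (fun y => v y + w y) = bDeriv ξ v + bDeriv ξ w := by
  have := apply_mul hξ (isBFun_exp hv) (isBFun_exp hw)
  simpa only [bDeriv, Real.exp_add] using this

theorem bDeriv_sub (hξ : ξ ∈ X.bTangentSpace x) (hv : X.SmoothNear v x) (hw : X.SmoothNear w x) :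
    bDeriv ξ (fun y => v y - w y) = bDeriv ξ v - bDeriv ξ w := by
  have h1 := bDeriv_add hξ hv ((smoothNear_const (-1)).mul hw)
  rw [bDeriv_const_mul hξ _ hw] at h1
  have e : (fun y => v y - w y) = fun y => v y + -1 * w y := by ext; ring
  rw [e, h1]; ring

theorem bDeriv_const (hξ : ξ ∈ X.bTangentSpace x) (c : ℝ) : bDeriv ξ (fun _ => c) = 0 := by
  have h1 := bDeriv_mul hξ (smoothNear_const 1) (smoothNear_const 1)
  have h2 := bDeriv_const_mul hξ c (smoothNear_const 1)
  simp only [mul_one, one_mul] at h1 h2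
  have h3 : bDeriv ξ (fun _ => (1 : ℝ)) = 0 := by linarith
  rw [h2, h3, mul_zero]

theorem bDeriv_sum {ι : Type*} {s : Finset ι} {f : ι → X → ℝ} (hξ : ξ ∈ X.bTangentSpace x)
    (hf : ∀ i ∈ s, X.SmoothNear (f i) x) :
    bDeriv ξ (fun y => ∑ i ∈ s, f i y) = ∑ i ∈ s, bDeriv ξ (f i) := by
  classical
  induction s using Finset.induction_on with
  | empty => simpa using bDeriv_const hξ 0
  | insert a s ha ih =>
    simp only [Finset.sum_insert ha]
    rw [bDeriv_add hξ (hf a (by simp)) (SmoothNear.sum fun i hi => hf i (by simp [hi])),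
      ih fun i hi => hf i (by simp [hi])]

theorem apply_one (hξ : ξ ∈ X.bTangentSpace x) : ξ (fun _ => 1) = 0 := by
  have h1 : X.IsBFun (fun _ => (1 : ℝ)) x := isBFun_of_pos (smoothNear_const 1) one_pos
  have := apply_mul hξ h1 h1
  simp only [mul_one] at this
  linarith

theorem apply_pow (hξ : ξ ∈ X.bTangentSpace x) (hg : X.IsBFun g x) (k : ℕ) :
    ξ (fun y => g y ^ k) = k * ξ g := by
  induction k with
  | zero => simpa using apply_one hξ
  | succ k ih =>
    simp only [pow_succ]
    rw [apply_mul hξ (hg.pow k) hg, ih]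
    push_cast; ring

theorem apply_prod {ι : Type*} {s : Finset ι} {f : ι → X → ℝ} (hξ : ξ ∈ X.bTangentSpace x)
    (hf : ∀ i ∈ s, X.IsBFun (f i) x) : ξ (fun y => ∏ i ∈ s, f i y) = ∑ i ∈ s, ξ (f i) := by
  classical
  induction s using Finset.induction_on with
  | empty => simpa using apply_one hξ
  | insert a s ha ih =>
    simp only [Finset.prod_insert ha]
    rw [apply_mul hξ (hf a (by simp)) (IsBFun.prod fun i hi => hf i (by simp [hi])),
      ih fun i hi => hf i (by simp [hi]), Finset.sum_insert ha]

theorem apply_prod_coord_pow (hξ : ξ ∈ X.bTangentSpace x) (hφ : X.IsChartAt φ x) (a : Fin n → ℕ) :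
    ξ (fun y => ∏ j, (φ y).1 j ^ a j) = ∑ j, a j * ξ (fun y => (φ y).1 j) := by
  rw [apply_prod hξ fun j _ => (isBFun_coord hφ j).pow _]
  exact Finset.sum_congr rfl fun j _ => apply_pow hξ (isBFun_coord hφ j) _

/-- By Hadamard's lemma a b-tangent vector acts on smooth functions through their first
derivatives. -/
theorem bDeriv_eq_sum (hξ : ξ ∈ X.bTangentSpace x) (hφ : X.IsChartAt φ x)
    (hv : X.SmoothNear v x) :
    bDeriv ξ v = ∑ j, bPartial φ j v x * ξ (fun y => (φ y).1 j) := by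
  obtain ⟨f, hf, hfx, he⟩ := exists_taylor hφ hv
  have hs : ∀ j, X.SmoothNear (fun y => (φ y).1 j - (φ x).1 j) x := fun j =>
    (smoothNear_coord hφ j).sub (smoothNear_const _)
  rw [bDeriv_congr hξ hv he, bDeriv_add hξ (smoothNear_const _)
    (SmoothNear.sum fun j _ => (hs j).mul (hf j)), bDeriv_const hξ, zero_add,
    bDeriv_sum hξ fun j _ => (hs j).mul (hf j)]
  refine Finset.sum_congr rfl fun j _ => ?_
  rw [bDeriv_mul hξ (hs j) (hf j), bDeriv_sub hξ (smoothNear_coord hφ j) (smoothNear_const _),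
    bDeriv_const hξ, bDeriv_isBFun hξ (isBFun_coord hφ j), hfx, bPartial]
  ring

open Classical in
/-- The b-tangent vector `φⱼ ∂/∂φⱼ` at `y`. Its value on `v · ∏ⱼ φⱼ ^ aⱼ` is `aⱼ + φⱼ ∂v/∂φⱼ / v`,
read off from some representation of this form; see `bFrame_apply` for the independence of the
choice. -/
def bFrame {X : CornerManifold.{u} n} (φ : OpenPartialHomeomorph X (EuclideanQuadrant n))
    (j : Fin n) (y : X) : LogFunctional X := fun g =>
  if H : ∃ p : (Fin n → ℕ) × (X → ℝ), HasBForm φ y g p.1 p.2 then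
    H.choose.1 j + bPartial φ j H.choose.2 y / H.choose.2 y else 0

theorem bFrame_apply {a : Fin n → ℕ} (H : HasBForm φ x g a v) (hφ : X.IsChartAt φ x) (j : Fin n) :
    bFrame φ j x g = a j + bPartial φ j v x / v x := by
  have H' : ∃ p : (Fin n → ℕ) × (X → ℝ), HasBForm φ x g p.1 p.2 := ⟨(a, v), H⟩
  rw [bFrame, dif_pos H']
  exact H'.choose_spec.coeff_unique H hφ j

theorem bFrame_pos (hv : X.SmoothNear v x) (h0 : 0 < v x) (hφ : X.IsChartAt φ x) (j : Fin n) :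
    bFrame φ j x v = bPartial φ j v x / v x := by
  rw [bFrame_apply (hasBForm_of_pos hv h0) hφ]; simp

theorem bDeriv_bFrame (hv : X.SmoothNear v x) (hφ : X.IsChartAt φ x) (j : Fin n) :
    bDeriv (bFrame φ j x) v = bPartial φ j v x := by
  rw [bDeriv, bFrame_pos hv.exp (Real.exp_pos _) hφ, bPartial_exp hφ hv]
  field_simp

theorem bFrame_mem (hφ : X.IsChartAt φ x) (j : Fin n) : bFrame φ j x ∈ X.bTangentSpace x := by
  refine ⟨fun g hg => ?_, fun g h hg e => ?_, fun g h hg hh => ?_, fun c f hf => ?_,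
    fun f h hf hh => ?_, fun g hg => ?_⟩
  · rw [bFrame, dif_neg]
    rintro ⟨p, hp⟩
    exact hg (hp.isBFun hφ)
  · obtain ⟨a, v, H⟩ := hg.exists_hasBForm hφ
    rw [bFrame_apply H hφ, bFrame_apply (H.congr e) hφ]
  · obtain ⟨a, v, H⟩ := hg.exists_hasBForm hφ
    obtain ⟨b, w, K⟩ := hh.exists_hasBForm hφ
    rw [bFrame_apply H hφ, bFrame_apply K hφ, bFrame_apply (H.mul K) hφ, bPartial_mul hφ H.1 K.1]
    have := H.2.1.ne'
    have := K.2.1.ne'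
    simp only [Pi.add_apply, Nat.cast_add]
    field_simp
    ring
  · rw [bDeriv_bFrame hf hφ, bDeriv_bFrame ((smoothNear_const c).mul hf) hφ,
      bPartial_mul hφ (smoothNear_const c) hf, bPartial_const]
    ring
  · rw [bDeriv_bFrame hf hφ, bDeriv_bFrame hh hφ, bDeriv_bFrame (hf.mul hh) hφ,
      bPartial_mul hφ hf hh]
  · obtain ⟨a, v, H⟩ := hg.exists_hasBForm hφ
    rw [bDeriv_bFrame hg.smoothNear hφ, bFrame_apply H hφ, H.bPartial_eq hφ]

theorem bFrame_coord (hφ : X.IsChartAt φ x) (j k : Fin n) :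
    bFrame φ j x (fun y => (φ y).1 k) = if k = j then 1 else 0 := by
  rw [bFrame_apply (hasBForm_coord k) hφ, bPartial_const]
  simp [Pi.single_apply, eq_comm]

theorem smoothNear_bFrame (hφ : X.IsChartAt φ x) (hg : X.IsBFun g x) (j : Fin n) :
    X.SmoothNear (fun y => bFrame φ j y g) x := by
  obtain ⟨a, v, H⟩ := hg.exists_hasBForm hφ
  refine (H.smoothNear_coeff hφ j).congr ?_
  filter_upwards [H.eventually, hφ.eventually] with y h1 h2 using bFrame_apply h1 h2 j

theorem eq_sum_bFrame (hξ : ξ ∈ X.bTangentSpace x) (hφ : X.IsChartAt φ x) :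
    ξ = ∑ j, ξ (fun y => (φ y).1 j) • bFrame φ j x := by
  funext g
  by_cases hg : X.IsBFun g x
  · obtain ⟨a, v, H⟩ := hg.exists_hasBForm hφ
    have h1 := bDeriv_isBFun hξ (isBFun_of_pos H.1 H.2.1)
    rw [bDeriv_eq_sum hξ hφ H.1] at h1
    have h2 : ξ v = ∑ j, bPartial φ j v x / v x * ξ (fun y => (φ y).1 j) := by
      rw [← mul_right_inj' H.2.1.ne', ← h1, Finset.mul_sum]
      refine Finset.sum_congr rfl fun j _ => ?_
      have := H.2.1.ne'
      field_simp
    rw [apply_congr hξ hg H.2.2, apply_mul hξ (isBFun_of_pos H.1 H.2.1)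
      (IsBFun.prod fun j _ => (isBFun_coord hφ j).pow _), apply_prod_coord_pow hξ hφ, h2,
      ← Finset.sum_add_distrib, Finset.sum_apply]
    refine Finset.sum_congr rfl fun j _ => ?_
    rw [Pi.smul_apply, bFrame_apply H hφ, smul_eq_mul]
    ring
  · rw [apply_of_not_isBFun hξ hg, apply_of_not_isBFun
      (Submodule.sum_mem _ fun j _ => Submodule.smul_mem _ _ (bFrame_mem hφ j)) hg]

/-- The b-tangent vector `∑ⱼ cⱼ φⱼ ∂/∂φⱼ` at `y`. -/
def ofCoord {X : CornerManifold.{u} n} (φ : OpenPartialHomeomorph X (EuclideanQuadrant n)) (y : X) :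
    (Fin n → ℝ) →ₗ[ℝ] LogFunctional X := Fintype.linearCombination ℝ fun j => bFrame φ j y

theorem ofCoord_mem (hφ : X.IsChartAt φ x) (c : Fin n → ℝ) : ofCoord φ x c ∈ X.bTangentSpace x := by
  rw [ofCoord, Fintype.linearCombination_apply]
  exact Submodule.sum_mem _ fun j _ => Submodule.smul_mem _ _ (bFrame_mem hφ j)

theorem ofCoord_apply (c : Fin n → ℝ) (g : X → ℝ) :
    ofCoord φ x c g = ∑ j, c j * bFrame φ j x g := by
  simp [ofCoord, Fintype.linearCombination_apply, Finset.sum_apply]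

theorem ofCoord_coord (hφ : X.IsChartAt φ x) (c : Fin n → ℝ) (k : Fin n) :
    ofCoord φ x c (fun y => (φ y).1 k) = c k := by
  simp [ofCoord_apply, bFrame_coord hφ]

theorem ofCoord_injective (hφ : X.IsChartAt φ x) : Function.Injective (ofCoord φ x) :=
  fun c d h => funext fun k => by rw [← ofCoord_coord hφ c k, h, ofCoord_coord hφ]

/-- The b-tangent vectors `φⱼ ∂/∂φⱼ` span: a b-tangent vector is determined by its values on the
coordinates. -/
theorem ofCoord_apply_coord (hξ : ξ ∈ X.bTangentSpace x) (hφ : X.IsChartAt φ x) :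
    ofCoord φ x (fun j => ξ fun y => (φ y).1 j) = ξ := (eq_sum_bFrame hξ hφ).symm

theorem ext_coord (hξ : ξ ∈ X.bTangentSpace x) (hη : η ∈ X.bTangentSpace x)
    (hφ : X.IsChartAt φ x) (h : ∀ j, ξ (fun y => (φ y).1 j) = η (fun y => (φ y).1 j)) : ξ = η := by
  rw [← ofCoord_apply_coord hξ hφ, ← ofCoord_apply_coord hη hφ]
  simp only [h]

/-! ### The b-differential -/

variable {Y : CornerManifold.{u} m} {Z : CornerManifold.{u} l} {F : X → Y} {G : Y → Z}

theorem IsInteriorBMap.continuousAt (hF : IsInteriorBMap X Y F) : ContinuousAt F x :=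
  hF.1.continuous.continuousAt

theorem IsInteriorBMap.smoothNear (hF : IsInteriorBMap X Y F) {f : Y → ℝ}
    (hf : Y.SmoothNear f (F x)) : X.SmoothNear (fun y => f (F y)) x :=
  (hF.continuousAt.eventually hf).mono fun y hy => hy.comp y (hF.1 y)

theorem IsInteriorBMap.isBFun (hF : IsInteriorBMap X Y F) {g : Y → ℝ} (hg : Y.IsBFun g (F x)) :
    X.IsBFun (fun y => g (F y)) x := hF.2 x g hg

theorem bDiff_apply {g : Y → ℝ} (hg : Y.IsBFun g (F x)) (ξ : LogFunctional X) :
    bDiff F x ξ g = ξ (fun y => g (F y)) := if_pos hg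

theorem bDeriv_bDiff {f : Y → ℝ} (hf : Y.SmoothNear f (F x)) (ξ : LogFunctional X) :
    bDeriv (bDiff F x ξ) f = bDeriv ξ (fun y => f (F y)) := bDiff_apply (isBFun_exp hf) ξ

theorem bDiff_mem (hF : IsInteriorBMap X Y F) (hξ : ξ ∈ X.bTangentSpace x) :
    bDiff F x ξ ∈ Y.bTangentSpace (F x) := by
  refine ⟨fun g hg => if_neg hg, fun g h hg e => ?_, fun g h hg hh => ?_, fun c f hf => ?_,
    fun f h hf hh => ?_, fun g hg => ?_⟩
  · rw [bDiff_apply hg, bDiff_apply (hg.congr e)]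
    exact apply_congr hξ (hF.2 x g hg) (hF.continuousAt.eventually e)
  · rw [bDiff_apply hg, bDiff_apply hh, bDiff_apply (hg.mul hh)]
    exact apply_mul hξ (hF.2 x g hg) (hF.2 x h hh)
  · rw [bDeriv_bDiff hf, bDeriv_bDiff ((smoothNear_const c).mul hf)]
    exact bDeriv_const_mul hξ c (hF.smoothNear hf)
  · rw [bDeriv_bDiff hf, bDeriv_bDiff hh, bDeriv_bDiff (hf.mul hh)]
    exact bDeriv_mul hξ (hF.smoothNear hf) (hF.smoothNear hh)
  · rw [bDeriv_bDiff hg.smoothNear, bDiff_apply hg]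
    exact bDeriv_isBFun hξ (hF.2 x g hg)

theorem bDiff_comp (hG : IsInteriorBMap Y Z G) (ξ : LogFunctional X) :
    bDiff (G ∘ F) x ξ = bDiff G (F x) (bDiff F x ξ) := by
  funext g
  by_cases hg : Z.IsBFun g (G (F x))
  · rw [bDiff_apply hg]
    exact (bDiff_apply (F := G ∘ F) hg ξ).trans (bDiff_apply (hG.2 _ _ hg) ξ).symm
  · exact (if_neg hg).trans (if_neg hg).symm

theorem bDiff_id (hξ : ξ ∈ X.bTangentSpace x) : bDiff id x ξ = ξ := by
  funext g
  by_cases hg : X.IsBFun g x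
  · exact bDiff_apply (F := id) hg ξ
  · rw [apply_of_not_isBFun hξ hg]; exact if_neg hg

end CornerManifold

namespace CornerManifold
variable {n m l : ℕ}

variable {X : CornerManifold.{u} n} {Y : CornerManifold.{u} m} {Z : CornerManifold.{u} l} {x : X}

/-! ### b-fibrations -/

/-- In suitable coordinates the b-differential of a b-fibration is a constant matrix with a right
inverse: the rows of the matrix of exponents are non-zero and have disjoint supports. -/
theorem IsBFibration.exists_matrix {F : X → Y} (hF : IsBFibration X Y F) (x : X) :
    ∃ (φ : OpenPartialHomeomorph X (EuclideanQuadrant n))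
      (ψ : OpenPartialHomeomorph Y (EuclideanQuadrant m)) (A : Matrix (Fin m) (Fin n) ℝ)
      (B : Matrix (Fin n) (Fin m) ℝ), X.IsChartAt φ x ∧ Y.IsChartAt ψ (F x) ∧ A * B = 1 ∧
      ∀ᶠ y in 𝓝 x, ∀ ξ ∈ X.bTangentSpace y, ∀ i,
        bDiff F y ξ (fun z => (ψ z).1 i) = (A.mulVec fun j => ξ fun z => (φ z).1 j) i := by
  obtain ⟨hFb, -, hF⟩ := hF
  obtain ⟨φ, ψ, a, hφ, hψ, he, -, hint, hdisj⟩ := hF x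
  -- A zero row would make the boundary coordinate `ψᵢ` pull back to the constant `1`.
  have hne : ∀ i, ∃ j, a i j ≠ 0 := by
    intro i
    by_cases hi : (ψ (F x)).1 i = 0
    · by_contra! h0
      have := (he i).self_of_nhds
      simp [h0, hi] at this
    · obtain ⟨j, -, hj⟩ := hint i hi
      exact ⟨j, by simp [hj]⟩
  choose r hr using hne
  -- The right inverse picks one non-zero entry from each row.
  refine ⟨φ, ψ, Matrix.of fun i j => (a i j : ℝ),
    Matrix.of fun j i => if j = r i then (a i j : ℝ)⁻¹ else 0, hφ, hψ, ?_, ?_⟩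
  · ext i i'
    simp only [Matrix.mul_apply, Matrix.of_apply, mul_ite, mul_zero, Finset.sum_ite_eq',
      Finset.mem_univ, if_true]
    by_cases h : i = i'
    · subst h
      simp [hr i]
    · have : a i (r i') = 0 := by
        by_contra h0
        exact h (hdisj i i' _ h0 (hr i'))
      simp [this, Matrix.one_apply_ne h]
  · have hψ' := hFb.continuousAt.eventually hψ.eventually
    filter_upwards [hφ.eventually, hψ', (Filter.eventually_all.2 he).eventually_nhds]
      with y hφy hψy hey ξ hξ i
    rw [bDiff_apply (isBFun_coord hψy i), apply_congr hξ (hFb.isBFun (isBFun_coord hψy i))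
      (hey.mono fun z hz => hz i), apply_prod_coord_pow hξ hφy]
    rfl

/-- A constant right inverse of the matrix of a b-fibration lifts b-tangent vectors. -/
theorem bDiff_ofCoord_mulVec {F : X → Y} (hF : IsInteriorBMap X Y F)
    {φ : OpenPartialHomeomorph X (EuclideanQuadrant n)}
    {ψ : OpenPartialHomeomorph Y (EuclideanQuadrant m)} {A : Matrix (Fin m) (Fin n) ℝ}
    {B : Matrix (Fin n) (Fin m) ℝ} (hφ : X.IsChartAt φ x) (hψ : Y.IsChartAt ψ (F x))
    (hAB : A * B = 1) (hA : ∀ ξ ∈ X.bTangentSpace x, ∀ i,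
      bDiff F x ξ (fun z => (ψ z).1 i) = (A.mulVec fun j => ξ fun z => (φ z).1 j) i)
    {η : LogFunctional Y} (hη : η ∈ Y.bTangentSpace (F x)) :
    bDiff F x (ofCoord φ x (B.mulVec fun i => η fun z => (ψ z).1 i)) = η := by
  refine ext_coord (bDiff_mem hF (ofCoord_mem hφ _)) hη hψ fun i => ?_
  rw [hA _ (ofCoord_mem hφ _)]
  simp only [ofCoord_coord hφ]
  rw [Matrix.mulVec_mulVec, hAB, Matrix.one_mulVec]

theorem IsBFibration.exists_bDiff_eq {F : X → Y} (hF : IsBFibration X Y F) {η : LogFunctional Y}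
    (hη : η ∈ Y.bTangentSpace (F x)) : ∃ ξ ∈ X.bTangentSpace x, bDiff F x ξ = η := by
  obtain ⟨φ, ψ, A, B, hφ, hψ, hAB, hA⟩ := hF.exists_matrix x
  exact ⟨_, ofCoord_mem hφ _, bDiff_ofCoord_mulVec hF.1 hφ hψ hAB hA.self_of_nhds hη⟩

theorem smoothSectionAt_ofCoord {D : Z → X} (hD : IsInteriorBMap Z X D) {z : Z}
    {φ : OpenPartialHomeomorph X (EuclideanQuadrant n)} (hφ : X.IsChartAt φ (D z))
    {c : Fin n → Z → ℝ} (hc : ∀ j, Z.SmoothNear (c j) z) :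
    SmoothSectionAt D (fun z => ofCoord φ (D z) fun j => c j z) z := by
  intro g hg
  simp only [ofCoord_apply]
  exact SmoothNear.sum fun j _ => (hc j).mul (hD.smoothNear (smoothNear_bFrame hφ hg j))

/-- Smooth sections lift locally through the b-differential of a b-fibration. -/
theorem IsBFibration.exists_smooth_lift {F : X → Y} (hF : IsBFibration X Y F) {D : Z → X}
    (hD : IsInteriorBMap Z X D) {V : Z → LogFunctional Y}
    (hV : ∀ z, V z ∈ Y.bTangentSpace (F (D z))) {z : Z} (hVs : SmoothSectionAt (F ∘ D) V z) :
    ∃ ζ : Z → LogFunctional X, SmoothSectionAt D ζ z ∧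
      ∀ᶠ w in 𝓝 z, ζ w ∈ X.bTangentSpace (D w) ∧ bDiff F (D w) (ζ w) = V w := by
  obtain ⟨φ, ψ, A, B, hφ, hψ, hAB, hA⟩ := hF.exists_matrix (D z)
  refine ⟨fun w => ofCoord φ (D w) fun j => (B.mulVec fun i => V w fun y => (ψ y).1 i) j,
    smoothSectionAt_ofCoord hD hφ fun j => ?_, ?_⟩
  · exact SmoothNear.sum (s := Finset.univ) fun i _ =>
      (smoothNear_const (B j i)).mul (hVs _ (isBFun_coord hψ i))
  · have h1 := hD.continuousAt.eventually hφ.eventually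
    have h2 := hD.continuousAt.eventually (hF.1.continuousAt.eventually hψ.eventually)
    filter_upwards [h1, h2, hD.continuousAt.eventually hA] with w hw1 hw2 hw3
    exact ⟨ofCoord_mem hw1 _, bDiff_ofCoord_mulVec hF.1 hw1 hw2 hAB hw3 (hV w)⟩

/-- The null space of the b-differential of a b-fibration is a smooth vector bundle, whose rank is
the codimension. -/
theorem IsBFibration.isSmoothSubbundle {F : X → Y} (hF : IsBFibration X Y F) {D : Z → X}
    (hD : IsInteriorBMap Z X D) {k : ℕ} (hk : n = m + k) :
    IsSmoothSubbundle D (fun z => nullSpace F (D z)) k := by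
  refine ⟨fun z => inf_le_left, fun z => ?_⟩
  obtain ⟨φ, ψ, A, B, hφ, hψ, hAB, hA⟩ := hF.exists_matrix (D z)
  have hsurj : Function.Surjective A.mulVecLin := fun c =>
    ⟨B.mulVec c, by rw [Matrix.mulVecLin_apply, Matrix.mulVec_mulVec, hAB, Matrix.one_mulVec]⟩
  have hrank : Module.finrank ℝ (LinearMap.ker A.mulVecLin) = k := by
    have h1 := A.mulVecLin.finrank_range_add_finrank_ker
    rw [LinearMap.range_eq_top.2 hsurj, finrank_top, Module.finrank_fin_fun,
      Module.finrank_fin_fun] at h1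
    omega
  let β := Module.finBasisOfFinrankEq ℝ _ hrank
  have hβ : Submodule.span ℝ (range fun i => (β i : Fin n → ℝ)) = LinearMap.ker A.mulVecLin := by
    have := congrArg (Submodule.map (Submodule.subtype _)) β.span_eq
    rwa [Submodule.map_span, ← range_comp, Submodule.map_top, Submodule.range_subtype] at this
  have hβi : LinearIndependent ℝ fun i => (β i : Fin n → ℝ) :=
    β.linearIndependent.map' (Submodule.subtype _) (Submodule.ker_subtype _)
  have hnhds : ∀ᶠ w in 𝓝 z, X.IsChartAt φ (D w) ∧ Y.IsChartAt ψ (F (D w)) ∧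
      ∀ ξ ∈ X.bTangentSpace (D w), ∀ i,
        bDiff F (D w) ξ (fun z => (ψ z).1 i) = (A.mulVec fun j => ξ fun z => (φ z).1 j) i :=
    (hD.continuousAt.eventually hφ.eventually).and ((hD.continuousAt.eventually
      (hF.1.continuousAt.eventually hψ.eventually)).and (hD.continuousAt.eventually hA))
  obtain ⟨U, hU, hUo, hzU⟩ := mem_nhds_iff.1 hnhds
  refine ⟨U, hUo, hzU, fun i w => ofCoord φ (D w) (β i : Fin n → ℝ), fun i w hw => ?_,
    fun w hw => ⟨?_, ?_⟩⟩
  · exact smoothSectionAt_ofCoord hD (hU hw).1 fun j => smoothNear_const _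
  · exact hβi.map' _ (LinearMap.ker_eq_bot.2 (ofCoord_injective (hU hw).1))
  · obtain ⟨h1, h2, h3⟩ := hU hw
    have e : (range fun i => ofCoord φ (D w) (β i : Fin n → ℝ)) =
        ofCoord φ (D w) '' range fun i => (β i : Fin n → ℝ) := by rw [← range_comp]; rfl
    rw [e, ← Submodule.map_span, hβ]
    ext ξ
    constructor
    · rintro ⟨c, hc, rfl⟩
      have hc : A.mulVec c = 0 := hc
      refine ⟨ofCoord_mem h1 c, ?_⟩
      refine ext_coord (bDiff_mem hF.1 (ofCoord_mem h1 c)) (Submodule.zero_mem _) h2 fun i => ?_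
      rw [h3 _ (ofCoord_mem h1 c)]
      simp only [ofCoord_coord h1, hc]
      rfl
    · rintro ⟨hξ, hξ0⟩
      refine ⟨_, ?_, ofCoord_apply_coord hξ h1⟩
      have hξ0 : bDiff F (D w) ξ = 0 := hξ0
      refine funext fun i => ?_
      have := h3 ξ hξ i
      rw [hξ0] at this
      exact this.symm

theorem IsSmoothSubbundle.finrank_eq {D : Z → X} {E : Z → Submodule ℝ (LogFunctional X)} {k : ℕ}
    (hE : IsSmoothSubbundle D E k) (z : Z) :
    FiniteDimensional ℝ (E z) ∧ Module.finrank ℝ (E z) = k := by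
  obtain ⟨U, -, hzU, s, -, hs⟩ := hE.2 z
  obtain ⟨h1, h2⟩ := hs z hzU
  rw [← h2]
  refine ⟨FiniteDimensional.span_of_finite ℝ (finite_range _), ?_⟩
  rw [finrank_span_eq_card h1, Fintype.card_fin]

/-! ### The commutator of b-vector fields -/

section Bracket

variable {U V W : X → LogFunctional X} {f g : X → ℝ}

theorem smoothNear_apply (hV : V ∈ X.bVectorFields) (hg : X.IsBFun g x) :
    X.SmoothNear (fun y => V y g) x := hV.2 x g hg

theorem smoothNear_bDeriv (hV : V ∈ X.bVectorFields) (hf : X.SmoothNear f x) :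
    X.SmoothNear (fun y => bDeriv (V y) f) x := hV.2 x _ (isBFun_exp hf)

theorem bBracket_apply (V W : X → LogFunctional X) (hg : X.IsBFun g x) : bBracket V W x g =
    bDeriv (V x) (fun y => W y g) - bDeriv (W x) (fun y => V y g) := if_pos hg

theorem bDeriv_bBracket (V W : X → LogFunctional X) (hf : X.SmoothNear f x) :
    bDeriv (bBracket V W x) f =
      bDeriv (V x) (fun y => bDeriv (W y) f) - bDeriv (W x) (fun y => bDeriv (V y) f) :=
  bBracket_apply V W (isBFun_exp hf)

theorem bBracket_mem (hV : V ∈ X.bVectorFields) (hW : W ∈ X.bVectorFields) :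
    bBracket V W ∈ X.bVectorFields := by
  refine ⟨fun x => ⟨fun g hg => if_neg hg, fun g h hg e => ?_, fun g h hg hh => ?_,
    fun c f hf => ?_, fun f h hf hh => ?_, fun g hg => ?_⟩, fun x g hg => ?_⟩
  · have key : ∀ U ∈ X.bVectorFields, (fun y => U y g) =ᶠ[𝓝 x] fun y => U y h := fun U hU => by
      filter_upwards [hg.eventually, e.eventuallyEq_nhds] with y h1 h2
        using apply_congr (hU.1 y) h1 h2
    rw [bBracket_apply V W hg, bBracket_apply V W (hg.congr e),
      bDeriv_congr (hV.1 x) (smoothNear_apply hW hg) (key W hW),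
      bDeriv_congr (hW.1 x) (smoothNear_apply hV hg) (key V hV)]
  · have key : ∀ U ∈ X.bVectorFields,
        (fun y => U y fun z => g z * h z) =ᶠ[𝓝 x] fun y => U y g + U y h := fun U hU => by
      filter_upwards [hg.eventually, hh.eventually] with y h1 h2 using apply_mul (hU.1 y) h1 h2
    rw [bBracket_apply V W hg, bBracket_apply V W hh, bBracket_apply V W (hg.mul hh),
      bDeriv_congr (hV.1 x) (smoothNear_apply hW (hg.mul hh)) (key W hW),
      bDeriv_congr (hW.1 x) (smoothNear_apply hV (hg.mul hh)) (key V hV),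
      bDeriv_add (hV.1 x) (smoothNear_apply hW hg) (smoothNear_apply hW hh),
      bDeriv_add (hW.1 x) (smoothNear_apply hV hg) (smoothNear_apply hV hh)]
    ring
  · have hcf := (smoothNear_const (X := X) (x := x) c).mul hf
    have key : ∀ U ∈ X.bVectorFields,
        (fun y => bDeriv (U y) fun z => c * f z) =ᶠ[𝓝 x] fun y => c * bDeriv (U y) f :=
      fun U hU => by
        filter_upwards [hf.eventually] with y h1 using bDeriv_const_mul (hU.1 y) c h1
    rw [bDeriv_bBracket V W hf, bDeriv_bBracket V W hcf,
      bDeriv_congr (hV.1 x) (smoothNear_bDeriv hW hcf) (key W hW),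
      bDeriv_congr (hW.1 x) (smoothNear_bDeriv hV hcf) (key V hV),
      bDeriv_const_mul (hV.1 x) c (smoothNear_bDeriv hW hf),
      bDeriv_const_mul (hW.1 x) c (smoothNear_bDeriv hV hf)]
    ring
  · have key : ∀ U ∈ X.bVectorFields, (fun y => bDeriv (U y) fun z => f z * h z) =ᶠ[𝓝 x]
        fun y => f y * bDeriv (U y) h + h y * bDeriv (U y) f := fun U hU => by
      filter_upwards [hf.eventually, hh.eventually] with y h1 h2 using bDeriv_mul (hU.1 y) h1 h2
    have expand : ∀ U ∈ X.bVectorFields, ∀ T ∈ X.bVectorFields,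
        bDeriv (U x) (fun y => bDeriv (T y) fun z => f z * h z) =
          f x * bDeriv (U x) (fun y => bDeriv (T y) h) + bDeriv (T x) h * bDeriv (U x) f +
          (h x * bDeriv (U x) (fun y => bDeriv (T y) f) + bDeriv (T x) f * bDeriv (U x) h) := by
      intro U hU T hT
      rw [bDeriv_congr (hU.1 x) (smoothNear_bDeriv hT (hf.mul hh)) (key T hT),
        bDeriv_add (hU.1 x) (hf.mul (smoothNear_bDeriv hT hh)) (hh.mul (smoothNear_bDeriv hT hf)),
        bDeriv_mul (hU.1 x) hf (smoothNear_bDeriv hT hh),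
        bDeriv_mul (hU.1 x) hh (smoothNear_bDeriv hT hf)]
    rw [bDeriv_bBracket V W hf, bDeriv_bBracket V W hh, bDeriv_bBracket V W (hf.mul hh),
      expand V hV W hW, expand W hW V hV]
    ring
  · have key : ∀ U ∈ X.bVectorFields,
        (fun y => bDeriv (U y) g) =ᶠ[𝓝 x] fun y => g y * U y g := fun U hU => by
      filter_upwards [hg.eventually] with y h1 using bDeriv_isBFun (hU.1 y) h1
    have expand : ∀ U ∈ X.bVectorFields, ∀ T ∈ X.bVectorFields,
        bDeriv (U x) (fun y => bDeriv (T y) g) =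
          g x * bDeriv (U x) (fun y => T y g) + T x g * (g x * U x g) := by
      intro U hU T hT
      rw [bDeriv_congr (hU.1 x) (smoothNear_bDeriv hT hg.smoothNear) (key T hT),
        bDeriv_mul (hU.1 x) hg.smoothNear (smoothNear_apply hT hg), bDeriv_isBFun (hU.1 x) hg]
    rw [bDeriv_bBracket V W hg.smoothNear, bBracket_apply V W hg, expand V hV W hW,
      expand W hW V hV]
    ring
  · refine ((smoothNear_bDeriv hV (smoothNear_apply hW hg)).sub
      (smoothNear_bDeriv hW (smoothNear_apply hV hg))).congr ?_
    filter_upwards [hg.eventually] with y hy using bBracket_apply V W hy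

theorem bBracket_self (V : X → LogFunctional X) : bBracket V V = 0 := by
  funext x g
  by_cases hg : X.IsBFun g x
  · rw [bBracket_apply V V hg, sub_self]; rfl
  · exact if_neg hg

theorem bBracket_swap (V W : X → LogFunctional X) : bBracket V W = -bBracket W V := by
  funext x g
  by_cases hg : X.IsBFun g x
  · rw [bBracket_apply V W hg, Pi.neg_apply, Pi.neg_apply, bBracket_apply W V hg, neg_sub]
  · exact (if_neg hg).trans (neg_eq_zero.2 (if_neg hg)).symm

theorem bBracket_add_left (hU : U ∈ X.bVectorFields) (hV : V ∈ X.bVectorFields)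
    (hW : W ∈ X.bVectorFields) : bBracket (U + V) W = bBracket U W + bBracket V W := by
  funext x g
  by_cases hg : X.IsBFun g x
  · simp only [Pi.add_apply, bBracket_apply _ _ hg]
    rw [bDeriv_add (hW.1 x) (smoothNear_apply hU hg) (smoothNear_apply hV hg)]
    simp only [bDeriv, Pi.add_apply]
    ring
  · exact (if_neg hg).trans ((congrArg₂ _ (if_neg hg) (if_neg hg)).trans (add_zero 0)).symm

theorem bBracket_smul_left (c : ℝ) (hV : V ∈ X.bVectorFields)
    (hW : W ∈ X.bVectorFields) : bBracket (c • V) W = c • bBracket V W := by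
  funext x g
  by_cases hg : X.IsBFun g x
  · simp only [Pi.smul_apply, bBracket_apply _ _ hg, smul_eq_mul]
    rw [bDeriv_const_mul (hW.1 x) c (smoothNear_apply hV hg)]
    simp only [bDeriv, Pi.smul_apply, smul_eq_mul]
    ring
  · exact (if_neg hg).trans ((congrArg _ (if_neg hg)).trans (smul_zero c)).symm

theorem bBracket_smul_right (hV : V ∈ X.bVectorFields) (hW : W ∈ X.bVectorFields)
    (hf : X.SmoothNear f x) : bBracket V (fun y => f y • W y) x =
      f x • bBracket V W x + bDeriv (V x) f • W x := by
  funext g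
  by_cases hg : X.IsBFun g x
  · simp only [Pi.add_apply, Pi.smul_apply, bBracket_apply _ _ hg, smul_eq_mul]
    rw [bDeriv_mul (hV.1 x) hf (smoothNear_apply hW hg)]
    simp only [bDeriv, Pi.smul_apply, smul_eq_mul]
    ring
  · simp only [Pi.add_apply, Pi.smul_apply, apply_of_not_isBFun (hW.1 x) hg,
      apply_of_not_isBFun ((bBracket_mem hV hW).1 x) hg]
    rw [bBracket, if_neg hg]
    simp

theorem bBracket_jacobi (hU : U ∈ X.bVectorFields) (hV : V ∈ X.bVectorFields)
    (hW : W ∈ X.bVectorFields) :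
    bBracket U (bBracket V W) + bBracket V (bBracket W U) + bBracket W (bBracket U V) = 0 := by
  funext x g
  by_cases hg : X.IsBFun g x
  · have expand : ∀ U ∈ X.bVectorFields, ∀ V ∈ X.bVectorFields, ∀ W ∈ X.bVectorFields,
        bBracket U (bBracket V W) x g =
          bDeriv (U x) (fun y => bDeriv (V y) fun z => W z g)
            - bDeriv (U x) (fun y => bDeriv (W y) fun z => V z g)
          - (bDeriv (V x) (fun y => bDeriv (W y) fun z => U z g)
            - bDeriv (W x) (fun y => bDeriv (V y) fun z => U z g)) := by
      intro U hU V hV W hW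
      have h1 := smoothNear_bDeriv hV (smoothNear_apply hW hg)
      have h2 := smoothNear_bDeriv hW (smoothNear_apply hV hg)
      have key : (fun y => bBracket V W y g) =ᶠ[𝓝 x]
          fun y => bDeriv (V y) (fun z => W z g) - bDeriv (W y) (fun z => V z g) := by
        filter_upwards [hg.eventually] with y hy using bBracket_apply V W hy
      rw [bBracket_apply _ _ hg, bDeriv_bBracket V W (smoothNear_apply hU hg),
        bDeriv_congr (hU.1 x) (smoothNear_apply (bBracket_mem hV hW) hg) key,
        bDeriv_sub (hU.1 x) h1 h2]
    simp only [Pi.add_apply, expand U hU V hV W hW, expand V hV W hW U hU, expand W hW U hU V hV,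
      Pi.zero_apply]
    ring
  · have h0 : ∀ V W : X → LogFunctional X, bBracket V W x g = 0 := fun V W => if_neg hg
    simp [h0]

/-- The commutators of related b-vector fields are related. -/
theorem bDiff_bBracket {F : X → Y} (hF : IsInteriorBMap X Y F) {V' W' : Y → LogFunctional Y}
    (hV : V ∈ X.bVectorFields) (hW : W ∈ X.bVectorFields) (hV' : V' ∈ Y.bVectorFields)
    (hW' : W' ∈ Y.bVectorFields) (hVV' : ∀ x, bDiff F x (V x) = V' (F x))
    (hWW' : ∀ x, bDiff F x (W x) = W' (F x)) (x : X) :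
    bDiff F x (bBracket V W x) = bBracket V' W' (F x) := by
  have key : ∀ U ∈ X.bVectorFields, ∀ T ∈ X.bVectorFields, ∀ U' T' : Y → LogFunctional Y,
      T' ∈ Y.bVectorFields → bDiff F x (U x) = U' (F x) → (∀ x, bDiff F x (T x) = T' (F x)) →
      ∀ g, Y.IsBFun g (F x) →
      bDeriv (U x) (fun y => T y fun z => g (F z)) = bDeriv (U' (F x)) (fun y => T' y g) := by
    intro U hU T hT U' T' hT' hUU' hTT' g hg
    have e : (fun y => T y fun z => g (F z)) =ᶠ[𝓝 x] fun y => T' (F y) g := by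
      filter_upwards [hF.continuousAt.eventually hg.eventually] with y hy
      rw [← hTT', bDiff_apply hy]
    rw [bDeriv_congr (hU.1 x) (smoothNear_apply hT (hF.isBFun hg)) e, ← hUU',
      bDeriv_bDiff (smoothNear_apply hT' hg)]
  funext g
  by_cases hg : Y.IsBFun g (F x)
  · rw [bDiff_apply hg, bBracket_apply V' W' hg, bBracket_apply V W (hF.isBFun hg)]
    rw [key V hV W hW V' W' hW' (hVV' x) hWW' g hg, key W hW V hV W' V' hV' (hWW' x) hVV' g hg]
  · exact (if_neg hg).trans (if_neg hg).symm

end Bracket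

end CornerManifold

/-! ### Sections along maps -/

namespace CornerManifold

variable {n m l : ℕ} {X : CornerManifold.{u} n} {Y : CornerManifold.{u} m}
  {Z : CornerManifold.{u} l}

theorem SmoothSectionAt.congr_map {D D' : Z → X} {V : Z → LogFunctional X} {z : Z}
    (hV : SmoothSectionAt D V z) (h : D z = D' z) : SmoothSectionAt D' V z := by
  unfold SmoothSectionAt at *
  rwa [← h]

theorem SmoothSectionAt.congr {D : Z → X} {V W : Z → LogFunctional X} {z : Z}
    (hV : SmoothSectionAt D V z) (h : W =ᶠ[𝓝 z] V) : SmoothSectionAt D W z := fun g hg =>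
  (hV g hg).congr (h.mono fun _ hw => congrFun hw g)

theorem SmoothSectionAt.sub {D : Z → X} {V W : Z → LogFunctional X} {z : Z}
    (hV : SmoothSectionAt D V z) (hW : SmoothSectionAt D W z) : SmoothSectionAt D (V - W) z :=
  fun g hg => (hV g hg).sub (hW g hg)

theorem SmoothSectionAt.bDiff {D : Z → X} {F : X → Y} {V : Z → LogFunctional X}
    (hF : IsInteriorBMap X Y F) (hD : IsInteriorBMap Z X D) {z : Z} (hV : SmoothSectionAt D V z) :
    SmoothSectionAt (F ∘ D) (fun w => CornerManifold.bDiff F (D w) (V w)) z := by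
  intro g hg
  refine (hV _ (hF.isBFun hg)).congr ?_
  filter_upwards [hD.continuousAt.eventually (hF.continuousAt.eventually hg.eventually)] with w hw
    using bDiff_apply hw _

end CornerManifold

namespace GeneralizedProduct

open CornerManifold

variable {μ κ : ℕ} (P : GeneralizedProduct.{u} μ κ)

/-! ### Structure maps of a generalized product -/

/-- The structure map written `(p₀, …, pₗ₊₁) ↦ (p₁, …, pₗ₊₁)` if the generalized product is thought
of as a product. -/
def dropFst (l : ℕ) : P.M (l + 1) → P.M l := P.S Fin.succ

/-- `(p₀, …, pₗ₊₁) ↦ (p₀, p₂, …, pₗ₊₁)`. -/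
def dropSnd (l : ℕ) : P.M (l + 1) → P.M l := P.S (Fin.succAbove 1)

/-- `(p₀, …, pₗ) ↦ (p₀, p₀, p₁, …, pₗ)`. -/
def dblFst (l : ℕ) : P.M l → P.M (l + 1) := P.S (Fin.cases 0 id)

/-- `(p₀, …, pₗ₊₁) ↦ (p₀, p₁)`. -/
def firstTwo (l : ℕ) : P.M (l + 1) → P.M 1 := P.S ![0, 1]

/-- `(p₀, …, pₗ) ↦ p₀`. -/
def first (l : ℕ) : P.M l → P.M 0 := P.S ![0]

variable {P} {j k l : ℕ}

theorem index_eq {α : Type*} (I I' : α → Fin (0 + 1)) : I = I' :=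
  funext fun _ => Subsingleton.elim (α := Fin 1) _ _

theorem S_S (K : Fin (j + 1) → Fin (k + 1)) (I : Fin (k + 1) → Fin (l + 1)) (r : P.M l) :
    P.S K (P.S I r) = P.S (I ∘ K) r := (congrFun (P.map_comp K I) r).symm

theorem bDiff_S_S (K : Fin (j + 1) → Fin (k + 1)) (I : Fin (k + 1) → Fin (l + 1)) (r : P.M l)
    (ξ : LogFunctional (P.M l)) :
    bDiff (P.S K) (P.S I r) (bDiff (P.S I) r ξ) = bDiff (P.S (I ∘ K)) r ξ := by
  rw [← bDiff_comp (P.bMap K), ← P.map_comp]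

theorem bDiff_S_mem (I : Fin (k + 1) → Fin (l + 1)) {r : P.M l} {ξ : LogFunctional (P.M l)}
    (hξ : ξ ∈ (P.M l).bTangentSpace r) : bDiff (P.S I) r ξ ∈ (P.M k).bTangentSpace (P.S I r) :=
  bDiff_mem (P.bMap I) hξ

theorem bDiff_S_id {r : P.M l} {ξ : LogFunctional (P.M l)}
    (hξ : ξ ∈ (P.M l).bTangentSpace r) : bDiff (P.S id) r ξ = ξ := by
  rw [P.map_id, bDiff_id hξ]

theorem dropFst_dblFst (r : P.M l) : P.dropFst l (P.dblFst l r) = r := by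
  rw [dropFst, dblFst, S_S, show (Fin.cases 0 id : Fin (l + 1 + 1) → Fin (l + 1)) ∘ Fin.succ = id
    from rfl, P.map_id, id]

theorem dbl_comp_skip :
    (Fin.cases 0 id : Fin (l + 1 + 1) → Fin (l + 1)) ∘ Fin.succAbove 1 = id := by
  funext i
  refine Fin.cases ?_ (fun i => ?_) i
  · simp
  · simp [Fin.succAbove, Fin.lt_def]

theorem dropSnd_dblFst (r : P.M l) : P.dropSnd l (P.dblFst l r) = r := by
  rw [dropSnd, dblFst, S_S, dbl_comp_skip, P.map_id, id]

theorem dbl_comp_pair : (Fin.cases 0 id : Fin (l + 1 + 1) → Fin (l + 1)) ∘ ![0, 1] =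
    ![0] ∘ ![0, 0] := by
  funext i
  fin_cases i <;> rfl

theorem succ_comp_zero : (Fin.succ : Fin (l + 1) → Fin (l + 1 + 1)) ∘ ![0] =
    ![0, 1] ∘ ![1] := by
  funext i
  fin_cases i
  rfl

theorem firstTwo_dblFst (r : P.M l) : P.firstTwo l (P.dblFst l r) = P.diag (P.first l r) := by
  rw [firstTwo, dblFst, diag, first, S_S, S_S, dbl_comp_pair]

theorem isBFibration_firstTwo : IsBFibration (P.M (l + 1)) (P.M 1) (P.firstTwo l) := by
  refine P.bFibration _ fun i i' h => ?_
  fin_cases i <;> fin_cases i' <;> simp_all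

theorem bDiff_first_dropFst (r : P.M (l + 1)) (ξ : LogFunctional (P.M (l + 1))) :
    bDiff (P.first l) (P.dropFst l r) (bDiff (P.dropFst l) r ξ) =
      bDiff P.projR (P.firstTwo l r) (bDiff (P.firstTwo l) r ξ) := by
  rw [first, dropFst, projR, firstTwo, bDiff_S_S, bDiff_S_S, succ_comp_zero]

/-! ### Lifting over the partial diagonals -/

/-- `ξ` is a lift of the vector `e ∈ E` at `p₀` to the point `(p₀, p₀, p₁, …, pₗ)`: it is tangent
to the first factor and is mapped to `e` by the projection to the first two factors. -/
def IsLiftAt (r : P.M l) (e : LogFunctional (P.M 1)) (ξ : LogFunctional (P.M (l + 1))) : Prop :=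
  ξ ∈ nullSpace (P.dropFst l) (P.dblFst l r) ∧ bDiff (P.firstTwo l) (P.dblFst l r) ξ = e

theorem bDiff_dropFst_dblFst {r : P.M l} {θ : LogFunctional (P.M l)}
    (hθ : θ ∈ (P.M l).bTangentSpace r) :
    bDiff (P.dropFst l) (P.dblFst l r) (bDiff (P.dblFst l) r θ) = θ := by
  rw [dropFst, dblFst, bDiff_S_S]
  exact bDiff_S_id hθ

/-- Subtracting from a b-tangent vector its component along the partial diagonal yields a lift. -/
theorem isLiftAt_sub {r : P.M l} {e : LogFunctional (P.M 1)} (he : e ∈ P.E (P.first l r))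
    {ζ : LogFunctional (P.M (l + 1))} (hζ : ζ ∈ (P.M (l + 1)).bTangentSpace (P.dblFst l r))
    (hζe : bDiff (P.firstTwo l) (P.dblFst l r) ζ = e) :
    IsLiftAt r e (ζ - bDiff (P.dblFst l) r (bDiff (P.dropFst l) (P.dblFst l r) ζ)) := by
  have hθ : bDiff (P.dropFst l) (P.dblFst l r) ζ ∈ (P.M l).bTangentSpace r := by
    have := bDiff_mem (P.bMap Fin.succ) hζ
    change _ ∈ (P.M l).bTangentSpace (P.dropFst l (P.dblFst l r)) at this
    rwa [dropFst_dblFst] at this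
  refine ⟨⟨Submodule.sub_mem _ hζ (bDiff_S_mem _ hθ), ?_⟩, ?_⟩
  · rw [SetLike.mem_coe, LinearMap.mem_ker, map_sub, bDiff_dropFst_dblFst hθ, sub_self]
  · rw [map_sub, hζe, sub_eq_self]
    have h1 : bDiff (P.first l) r (bDiff (P.dropFst l) (P.dblFst l r) ζ) = 0 := by
      have := bDiff_first_dropFst (P.dblFst l r) ζ
      rw [dropFst_dblFst, hζe, firstTwo_dblFst] at this
      rw [this]
      exact he.2
    have h2 : ∀ θ, bDiff (P.firstTwo l) (P.dblFst l r) (bDiff (P.dblFst l) r θ) =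
        bDiff P.diag (P.first l r) (bDiff (P.first l) r θ) := by
      intro θ
      rw [firstTwo, dblFst, diag, first, bDiff_S_S, bDiff_S_S, dbl_comp_pair]
    rw [h2, h1, map_zero]

theorem exists_isLiftAt (r : P.M l) {e : LogFunctional (P.M 1)} (he : e ∈ P.E (P.first l r)) :
    ∃ ξ, IsLiftAt r e ξ := by
  have he' : e ∈ (P.M 1).bTangentSpace (P.firstTwo l (P.dblFst l r)) := by
    rw [firstTwo_dblFst]; exact he.1
  obtain ⟨ζ, hζ, hζe⟩ := isBFibration_firstTwo.exists_bDiff_eq he'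
  exact ⟨_, isLiftAt_sub he hζ hζe⟩

theorem isSmoothSubbundle_dropFst (l : ℕ) : IsSmoothSubbundle (P.dblFst l)
    (fun r => nullSpace (P.dropFst l) (P.dblFst l r)) κ :=
  (P.bFibration _ (Fin.succ_injective _)).isSmoothSubbundle (P.bMap _) (by ring)

theorem isSmoothSubbundle_E : IsSmoothSubbundle P.diag P.E κ :=
  (P.bFibration _ fun _ _ _ => Subsingleton.elim (α := Fin 1) _ _).isSmoothSubbundle (P.bMap _)
    (by ring)

theorem bDiff_firstTwo_mem {r : P.M l} {ξ : LogFunctional (P.M (l + 1))}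
    (hξ : ξ ∈ nullSpace (P.dropFst l) (P.dblFst l r)) :
    bDiff (P.firstTwo l) (P.dblFst l r) ξ ∈ P.E (P.first l r) := by
  unfold E
  rw [← firstTwo_dblFst]
  refine ⟨bDiff_S_mem _ hξ.1, ?_⟩
  rw [SetLike.mem_coe, LinearMap.mem_ker, ← bDiff_first_dropFst, LinearMap.mem_ker.1 hξ.2, map_zero]

/-- Vectors tangent to the first factor at the partial diagonal are determined by their image in
`E`, because the two spaces have the same dimension and every vector of `E` has a lift. -/
theorem IsLiftAt.unique {r : P.M l} {e : LogFunctional (P.M 1)} {ξ η : LogFunctional (P.M (l + 1))}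
    (hξ : IsLiftAt r e ξ) (hη : IsLiftAt r e η) : ξ = η := by
  obtain ⟨hfin, hrank⟩ := (isSmoothSubbundle_dropFst (P := P) l).finrank_eq r
  obtain ⟨hfin', hrank'⟩ := (isSmoothSubbundle_E (P := P)).finrank_eq (P.first l r)
  let T : nullSpace (P.dropFst l) (P.dblFst l r) →ₗ[ℝ] P.E (P.first l r) :=
    (bDiff (P.firstTwo l) (P.dblFst l r)).restrict fun _ h => bDiff_firstTwo_mem h
  have hT : Function.Surjective T := fun e => by
    obtain ⟨ξ, h1, h2⟩ := exists_isLiftAt r e.2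
    exact ⟨⟨ξ, h1⟩, Subtype.ext h2⟩
  have hinj := (LinearMap.injective_iff_surjective_of_finrank_eq_finrank
    (hrank.trans hrank'.symm)).2 hT
  exact congrArg Subtype.val (@hinj ⟨ξ, hξ.1⟩ ⟨η, hη.1⟩ (Subtype.ext (hξ.2.trans hη.2.symm)))

theorem IsLiftAt.add {r : P.M l} {e e' : LogFunctional (P.M 1)} {ξ η : LogFunctional (P.M (l + 1))}
    (hξ : IsLiftAt r e ξ) (hη : IsLiftAt r e' η) : IsLiftAt r (e + e') (ξ + η) :=
  ⟨Submodule.add_mem _ hξ.1 hη.1, by rw [map_add, hξ.2, hη.2]⟩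

theorem IsLiftAt.smul {r : P.M l} {e : LogFunctional (P.M 1)} {ξ : LogFunctional (P.M (l + 1))}
    (c : ℝ) (hξ : IsLiftAt r e ξ) : IsLiftAt r (c • e) (c • ξ) :=
  ⟨Submodule.smul_mem _ c hξ.1, by rw [map_smul, hξ.2]⟩

open Classical in
/-- The lift of the section `V` to the point `(p₀, p₀, p₁, …, pₗ)`; the value `0` where there is no
lift is not attained for sections of `E`, see `exists_isLiftAt`. -/
def lift (V : P.M 0 → LogFunctional (P.M 1)) (l : ℕ) (r : P.M l) : LogFunctional (P.M (l + 1)) :=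
  if h : ∃ ξ, IsLiftAt r (V (P.first l r)) ξ then h.choose else 0

variable {U V V₁ V₂ : P.M 0 → LogFunctional (P.M 1)}

theorem isLiftAt_lift (hV : V ∈ P.sections) (r : P.M l) :
    IsLiftAt r (V (P.first l r)) (lift V l r) := by
  have h : ∃ ξ, IsLiftAt r (V (P.first l r)) ξ := exists_isLiftAt r (hV.1 _)
  rw [lift, dif_pos h]
  exact h.choose_spec

theorem lift_eq (hV : V ∈ P.sections) {r : P.M l} {ξ : LogFunctional (P.M (l + 1))}
    (hξ : IsLiftAt r (V (P.first l r)) ξ) : lift V l r = ξ := (isLiftAt_lift hV r).unique hξ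

/-- Smoothness of the lift: near a point it is obtained from a smooth lift through the b-fibration
onto the first two factors by the correction of `isLiftAt_sub`. -/
theorem smoothSectionAt_lift (hV : V ∈ P.sections) (r : P.M l) :
    SmoothSectionAt (P.dblFst l) (lift V l) r := by
  have hD : IsInteriorBMap _ _ (P.dblFst l) := P.bMap _
  have hF : IsInteriorBMap _ _ (P.dropFst l) := P.bMap _
  have hVs : SmoothSectionAt (P.firstTwo l ∘ P.dblFst l) (fun r => V (P.first l r)) r := by
    intro g hg
    have hg : (P.M 1).IsBFun g (P.firstTwo l (P.dblFst l r)) := hg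
    rw [firstTwo_dblFst] at hg
    exact IsInteriorBMap.smoothNear (P.bMap ![0]) (hV.2 (P.first l r) g hg)
  obtain ⟨ζ, hζ, he⟩ := isBFibration_firstTwo.exists_smooth_lift hD
    (fun r => by rw [firstTwo_dblFst]; exact (hV.1 (P.first l r)).1) hVs
  have h1 : SmoothSectionAt (P.dropFst l ∘ P.dblFst l)
      (fun w => bDiff (P.dropFst l) (P.dblFst l w) (ζ w)) r := hζ.bDiff hF hD
  have h2 : SmoothSectionAt id (fun w => bDiff (P.dropFst l) (P.dblFst l w) (ζ w)) r :=
    h1.congr_map (dropFst_dblFst r)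
  have hid : IsInteriorBMap (P.M l) (P.M l) id := P.map_id l ▸ P.bMap id
  have h3 := h2.bDiff hD hid
  refine (hζ.sub h3).congr ?_
  filter_upwards [he] with w hw
  exact lift_eq hV (isLiftAt_sub (hV.1 _) hw.1 hw.2)

/-! ### The right-invariant vector fields -/

/-- The b-vector field on `M[l+1]` that acts by the section `V` of `E` on the first factor. -/
def rightInvariant (V : P.M 0 → LogFunctional (P.M 1)) (l : ℕ) (r : P.M l) :
    LogFunctional (P.M l) := bDiff (P.dropSnd l) (P.dblFst l r) (lift V l r)

theorem rightInvariant_mem (hV : V ∈ P.sections) (l : ℕ) :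
    rightInvariant V l ∈ (P.M l).bVectorFields := by
  refine ⟨fun r => ?_, fun r => ?_⟩
  · have h := bDiff_S_mem (Fin.succAbove 1) (isLiftAt_lift hV r).1.1
    change _ ∈ (P.M l).bTangentSpace (P.dropSnd l (P.dblFst l r)) at h
    rwa [dropSnd_dblFst] at h
  · exact ((smoothSectionAt_lift hV r).bDiff (F := P.dropSnd l) (P.bMap _) (P.bMap _)).congr_map
      (dropSnd_dblFst r)

theorem lift_add (hU : U ∈ P.sections) (hV : V ∈ P.sections) (r : P.M l) :
    lift (U + V) l r = lift U l r + lift V l r :=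
  lift_eq (Submodule.add_mem _ hU hV) ((isLiftAt_lift hU r).add (isLiftAt_lift hV r))

theorem rightInvariant_add (hU : U ∈ P.sections) (hV : V ∈ P.sections) :
    rightInvariant (U + V) l = rightInvariant U l + rightInvariant V l := by
  funext r
  simp only [rightInvariant, lift_add hU hV, map_add, Pi.add_apply]

theorem rightInvariant_fun_smul (hV : V ∈ P.sections) {f : P.M 0 → ℝ}
    (hfV : (fun p => f p • V p) ∈ P.sections) :
    rightInvariant (fun p => f p • V p) l = fun r => f (P.first l r) • rightInvariant V l r := by
  funext r
  rw [rightInvariant, lift_eq hfV ((isLiftAt_lift hV r).smul (f (P.first l r))), map_smul]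
  rfl

theorem skip_comp {K : Fin (k + 1) → Fin (l + 1)} (hK : ∀ i, K i ≠ 0) :
    Fin.succAbove 1 ∘ K = Fin.succ ∘ K := by
  funext i
  obtain ⟨j, hj⟩ := Fin.exists_succ_eq.2 (hK i)
  obtain ⟨l, rfl⟩ : ∃ l', l = l' + 1 := Nat.exists_eq_succ_of_ne_zero (by rintro rfl; exact j.elim0)
  simp [← hj]

/-- The right-invariant vector fields are tangent to the first factor: structure maps that forget it
annihilate them. -/
theorem bDiff_rightInvariant_eq_zero (hV : V ∈ P.sections) {K : Fin (k + 1) → Fin (l + 1)}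
    (hK : ∀ i, K i ≠ 0) (r : P.M l) : bDiff (P.S K) r (rightInvariant V l r) = 0 := by
  have h1 : ∀ ξ, bDiff (P.S K) r (bDiff (P.dropSnd l) (P.dblFst l r) ξ) =
      bDiff (P.S K) r (bDiff (P.dropFst l) (P.dblFst l r) ξ) := by
    intro ξ
    have h2 := bDiff_S_S K (Fin.succAbove 1) (P.dblFst l r) ξ
    have h3 := bDiff_S_S K Fin.succ (P.dblFst l r) ξ
    rw [skip_comp hK, ← h3] at h2
    change bDiff (P.S K) (P.dropSnd l (P.dblFst l r)) _ =
      bDiff (P.S K) (P.dropFst l (P.dblFst l r)) _ at h2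
    rwa [dropSnd_dblFst, dropFst_dblFst] at h2
  rw [rightInvariant, h1, LinearMap.mem_ker.1 (isLiftAt_lift hV r).1.2, map_zero]

/-- The right-invariant vector fields are related under the structure maps that keep the first
factor apart from the others. -/
theorem bDiff_rightInvariant (hV : V ∈ P.sections) {K : Fin (k + 1) → Fin (l + 1)} (h0 : K 0 = 0)
    (hK : ∀ i : Fin k, K i.succ ≠ 0) (r : P.M l) :
    bDiff (P.S K) r (rightInvariant V l r) = rightInvariant V k (P.S K r) := by
  -- `K'` extends `K` to the doubled first factor; it maps lifts to lifts.
  let K' : Fin (k + 1 + 1) → Fin (l + 1 + 1) := Fin.cases 0 fun i => (K i).succ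
  have e1 : (Fin.cases 0 id : Fin (l + 1 + 1) → Fin (l + 1)) ∘ K' = K ∘ Fin.cases 0 id := by
    funext i
    refine Fin.cases ?_ (fun i => ?_) i
    · simp [K', h0]
    · simp [K']
  have e2 : K' ∘ Fin.succ = Fin.succ ∘ K := rfl
  have e3 : K' ∘ ![0, 1] = ![0, 1] := by
    funext i
    fin_cases i
    · rfl
    · change (K 0).succ = 1
      rw [h0]; rfl
  have e4 : (Fin.succAbove 1) ∘ K = K' ∘ Fin.succAbove 1 := by
    funext i
    refine Fin.cases ?_ (fun i => ?_) i
    · simp [K', h0]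
    · have := congrFun (skip_comp (K := fun _ : Fin 1 => K i.succ) fun _ => hK i) 0
      obtain ⟨k, rfl⟩ : ∃ k', k = k' + 1 :=
        Nat.exists_eq_succ_of_ne_zero (by rintro rfl; exact i.elim0)
      simpa [K'] using this
  have hbase : P.S K' (P.dblFst l r) = P.dblFst k (P.S K r) := by
    rw [dblFst, dblFst, S_S, S_S, e1]
  have hfirst : P.first k (P.S K r) = P.first l r := by
    rw [first, first, S_S]
    congr 1
    funext i
    fin_cases i
    exact h0
  have hlift : lift V k (P.S K r) = bDiff (P.S K') (P.dblFst l r) (lift V l r) := by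
    obtain ⟨⟨h1, h2⟩, h3⟩ := isLiftAt_lift hV r
    refine lift_eq hV ⟨⟨?_, ?_⟩, ?_⟩
    · rw [← hbase]
      exact bDiff_S_mem K' h1
    · rw [SetLike.mem_coe, LinearMap.mem_ker, ← hbase, dropFst, bDiff_S_S, e2, ← bDiff_S_S]
      exact (congrArg _ (LinearMap.mem_ker.1 h2)).trans (map_zero _)
    · rw [← hbase, firstTwo, bDiff_S_S, e3, hfirst]
      exact h3
  have h4 := bDiff_S_S K (Fin.succAbove 1) (P.dblFst l r) (lift V l r)
  rw [e4, ← bDiff_S_S, ← hlift, hbase] at h4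
  change bDiff (P.S K) (P.dropSnd l (P.dblFst l r)) _ = _ at h4
  rwa [dropSnd_dblFst] at h4

/-- On `M[1]` the right-invariant vector field is the image of the section under the anchor. -/
theorem rightInvariant_zero (hV : V ∈ P.sections) :
    rightInvariant V 0 = fun p => P.anchor p (V p) := by
  have e1 : P.dblFst 0 = P.diag := congrArg P.S (index_eq _ _)
  have e2 : P.dropSnd 0 = P.projL := congrArg P.S (funext fun i => by fin_cases i; rfl)
  have e3 : P.firstTwo 0 = P.S id := congrArg P.S (funext fun i => by fin_cases i <;> rfl)
  have e4 : ∀ p, P.first 0 p = p := fun p => by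
    rw [first, index_eq ![0] (id : Fin (0 + 1) → Fin (0 + 1)), P.map_id, id]
  funext p
  have h := (isLiftAt_lift hV p)
  have h2 := h.2
  rw [e3, bDiff_S_id h.1.1, e4] at h2
  rw [rightInvariant, h2, e1, e2]
  rfl

theorem first_diag (p : P.M 0) : P.first 1 (P.diag p) = p := by
  rw [first, diag, S_S, index_eq (_ ∘ _) (id : Fin (0 + 1) → Fin (0 + 1)), P.map_id, id]

/-- On the diagonal the lift of `V` is the image of `V` under `(p₀, p₁) ↦ (p₀, p₁, p₁)`. -/
theorem rightInvariant_diag (hV : V ∈ P.sections) (p : P.M 0) :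
    rightInvariant V 1 (P.diag p) = V p := by
  have hbase : P.S ![0, 1, 1] (P.diag p) = P.dblFst 1 (P.diag p) := by
    rw [diag, dblFst, S_S, S_S]
    congr 1
    exact index_eq _ _
  obtain ⟨hp1, hp2⟩ := hV.1 p
  have hlift : lift V 1 (P.diag p) = bDiff (P.S ![0, 1, 1]) (P.diag p) (V p) := by
    refine lift_eq hV ⟨⟨?_, ?_⟩, ?_⟩
    · rw [← hbase]
      exact bDiff_S_mem _ hp1
    · have e : (![0, 1, 1] : Fin (1 + 1 + 1) → Fin (1 + 1)) ∘ Fin.succ = ![1] ∘ ![0, 0] := by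
        funext i
        fin_cases i <;> rfl
      rw [SetLike.mem_coe, LinearMap.mem_ker, ← hbase, dropFst, bDiff_S_S, e, ← bDiff_S_S]
      exact (congrArg _ (LinearMap.mem_ker.1 hp2)).trans (map_zero _)
    · have e : (![0, 1, 1] : Fin (1 + 1 + 1) → Fin (1 + 1)) ∘ ![0, 1] = id := by
        funext i
        fin_cases i <;> rfl
      rw [← hbase, firstTwo, bDiff_S_S, e, bDiff_S_id hp1, first_diag]
  have e : (![0, 1, 1] : Fin (1 + 1 + 1) → Fin (1 + 1)) ∘ Fin.succAbove 1 = id := by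
    funext i
    fin_cases i <;> rfl
  rw [rightInvariant, hlift, ← hbase, dropSnd, bDiff_S_S, e, bDiff_S_id hp1]

theorem bDiff_projR_rightInvariant (hV : V ∈ P.sections) (q : P.M 1) :
    bDiff P.projR q (rightInvariant V 1 q) = 0 :=
  bDiff_rightInvariant_eq_zero hV (fun i => by fin_cases i; simp) q

/-! ### The bracket -/

theorem bDiff_bBracket_eq_zero (hV₁ : V₁ ∈ P.sections) (hV₂ : V₂ ∈ P.sections)
    {K : Fin (k + 1) → Fin (l + 1)} (hK : ∀ i, K i ≠ 0) (r : P.M l) :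
    bDiff (P.S K) r (bBracket (rightInvariant V₁ l) (rightInvariant V₂ l) r) = 0 := by
  rw [bDiff_bBracket (P.bMap K) (V' := 0) (W' := 0) (rightInvariant_mem hV₁ l)
    (rightInvariant_mem hV₂ l) (Submodule.zero_mem _) (Submodule.zero_mem _)
    (bDiff_rightInvariant_eq_zero hV₁ hK) (bDiff_rightInvariant_eq_zero hV₂ hK), bBracket_self]
  rfl

theorem bDiff_bBracket_rightInvariant (hV₁ : V₁ ∈ P.sections) (hV₂ : V₂ ∈ P.sections)
    {K : Fin (k + 1) → Fin (l + 1)} (h0 : K 0 = 0) (hK : ∀ i : Fin k, K i.succ ≠ 0) (r : P.M l) :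
    bDiff (P.S K) r (bBracket (rightInvariant V₁ l) (rightInvariant V₂ l) r) =
      bBracket (rightInvariant V₁ k) (rightInvariant V₂ k) (P.S K r) :=
  bDiff_bBracket (P.bMap K) (rightInvariant_mem hV₁ l) (rightInvariant_mem hV₂ l)
    (rightInvariant_mem hV₁ k) (rightInvariant_mem hV₂ k) (bDiff_rightInvariant hV₁ h0 hK)
    (bDiff_rightInvariant hV₂ h0 hK) r

theorem bBracket_diag_mem (hV₁ : V₁ ∈ P.sections) (hV₂ : V₂ ∈ P.sections) :
    (fun p => bBracket (rightInvariant V₁ 1) (rightInvariant V₂ 1) (P.diag p)) ∈ P.sections := by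
  have hB := bBracket_mem (rightInvariant_mem hV₁ 1) (rightInvariant_mem hV₂ 1)
  refine ⟨fun p => ⟨hB.1 _, ?_⟩, fun p g hg => ?_⟩
  · exact bDiff_bBracket_eq_zero hV₁ hV₂ (K := ![1]) (fun i => by fin_cases i; simp) (P.diag p)
  · exact IsInteriorBMap.smoothNear (P.bMap ![0, 0]) (hB.2 (P.diag p) g hg)

variable (P) in
/-- The bracket of sections of `E`: the commutator of the right-invariant vector fields on `M[2]`,
restricted to the diagonal. -/
def bracket (V₁ V₂ : P.sections) : P.sections :=
  ⟨fun p => bBracket (rightInvariant V₁.1 1) (rightInvariant V₂.1 1) (P.diag p),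
    bBracket_diag_mem V₁.2 V₂.2⟩

/-- Commutators of right-invariant vector fields are right-invariant: at the partial diagonal the
commutator of the fields on `M[3]` is the lift of the bracket. -/
theorem rightInvariant_bracket (V₁ V₂ : P.sections) :
    rightInvariant (P.bracket V₁ V₂).1 1 =
      bBracket (rightInvariant V₁.1 1) (rightInvariant V₂.1 1) := by
  funext q
  have hlift : lift (P.bracket V₁ V₂).1 1 q =
      bBracket (rightInvariant V₁.1 2) (rightInvariant V₂.1 2) (P.dblFst 1 q) := by
    refine lift_eq (P.bracket V₁ V₂).2 ⟨⟨?_, ?_⟩, ?_⟩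
    · exact (bBracket_mem (rightInvariant_mem V₁.2 2) (rightInvariant_mem V₂.2 2)).1 _
    · exact bDiff_bBracket_eq_zero V₁.2 V₂.2 (fun i => Fin.succ_ne_zero i) _
    · refine (bDiff_bBracket_rightInvariant V₁.2 V₂.2 (K := ![0, 1]) rfl
        (fun i => by fin_cases i; simp) (P.dblFst 1 q)).trans ?_
      exact congrArg _ (firstTwo_dblFst q)
  rw [rightInvariant, hlift]
  refine (bDiff_bBracket_rightInvariant V₁.2 V₂.2 (K := Fin.succAbove 1) rfl
    (fun i => by fin_cases i; decide) (P.dblFst 1 q)).trans ?_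
  exact congrArg _ (dropSnd_dblFst q)

theorem bracket_swap (V W : P.sections) : P.bracket V W = -P.bracket W V :=
  Subtype.ext (funext fun p => congrFun (bBracket_swap _ _) (P.diag p))

theorem bracket_add_left (U V W : P.sections) :
    P.bracket (U + V) W = P.bracket U W + P.bracket V W := by
  refine Subtype.ext (funext fun p => ?_)
  have h := bBracket_add_left (rightInvariant_mem U.2 1) (rightInvariant_mem V.2 1)
    (rightInvariant_mem W.2 1)
  rw [← rightInvariant_add U.2 V.2] at h
  exact congrFun h (P.diag p)

theorem bracket_smul_left (c : ℝ) (V W : P.sections) :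
    P.bracket (c • V) W = c • P.bracket V W := by
  refine Subtype.ext (funext fun p => ?_)
  have h := bBracket_smul_left c (rightInvariant_mem V.2 1) (rightInvariant_mem W.2 1)
  have e : rightInvariant (c • V.1) 1 = c • rightInvariant V.1 1 :=
    rightInvariant_fun_smul (f := fun _ => c) V.2 (Submodule.smul_mem _ c V.2)
  rw [← e] at h
  exact congrFun h (P.diag p)

theorem bracket_smulSection (V W : P.sections) {f : P.M 0 → ℝ} (hf : (P.M 0).SmoothFun f)
    (p : P.M 0) : (P.bracket V (smulSection f hf W)).1 p =
      f p • (P.bracket V W).1 p + bDeriv (P.anchor p (V.1 p)) f • W.1 p := by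
  have hf' : ∀ p, (P.M 0).SmoothNear f p := fun p => Eventually.of_forall hf
  have hfL : (P.M 1).SmoothNear (fun q => f (P.first 1 q)) (P.diag p) :=
    IsInteriorBMap.smoothNear (P.bMap ![0]) (hf' _)
  have h := bBracket_smul_right (rightInvariant_mem V.2 1) (rightInvariant_mem W.2 1) hfL
  rw [rightInvariant_diag V.2, rightInvariant_diag W.2, first_diag,
    ← rightInvariant_fun_smul W.2 (smulSection f hf W).2] at h
  refine h.trans ?_
  rw [anchor, bDeriv_bDiff (hf' _)]
  rfl

theorem isLieAlgebroid (P : GeneralizedProduct.{u} μ κ) :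
    IsLieAlgebroid P.diag P.E κ P.anchor P.bracket where
  vectorBundle := isSmoothSubbundle_E
  add_left := bracket_add_left
  smul_left := bracket_smul_left
  add_right U V W := by
    rw [bracket_swap, bracket_add_left, neg_add, ← bracket_swap, ← bracket_swap]
  smul_right c V W := by
    rw [bracket_swap, bracket_smul_left, bracket_swap W, smul_neg, neg_neg]
  bracket_self V := Subtype.ext (funext fun p => congrFun (bBracket_self _) (P.diag p))
  jacobi U V W := by
    refine Subtype.ext (funext fun p => ?_)
    have h := bBracket_jacobi (rightInvariant_mem U.2 1) (rightInvariant_mem V.2 1)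
      (rightInvariant_mem W.2 1)
    rw [← rightInvariant_bracket V W, ← rightInvariant_bracket W U,
      ← rightInvariant_bracket U V] at h
    exact congrFun h (P.diag p)
  anchor_mem V := rightInvariant_zero V.2 ▸ rightInvariant_mem V.2 0
  anchor_bracket V W := by
    rw [← rightInvariant_zero V.2, ← rightInvariant_zero W.2]
    funext p
    have h := bDiff_bBracket_rightInvariant V.2 W.2 (K := ![0]) rfl (fun i => i.elim0) (P.diag p)
    refine h.trans (congrArg _ (first_diag p))
  leibniz V W f hf p := bracket_smulSection V W hf p

/-! ### Lifts of sections -/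

theorem isLift_iff {W : P.M 1 → LogFunctional (P.M 2)} : P.IsLift V W ↔
    (∀ q, SmoothSectionAt (P.dblFst 1) W q) ∧ ∀ q, IsLiftAt q (V (P.first 1 q)) (W q) := by
  have e1 : P.diag12 = P.dblFst 1 := congrArg P.S (funext fun i => by fin_cases i <;> rfl)
  have e2 : P.projF = P.dropFst 1 := congrArg P.S (funext fun i => by fin_cases i <;> rfl)
  have e3 : P.projS = P.firstTwo 1 := rfl
  have e4 : P.projL = P.first 1 := rfl
  unfold IsLift
  rw [e1, e2, e3, e4]
  exact ⟨fun h => ⟨h.1.2, fun q => ⟨h.1.1 q, h.2 q⟩⟩, fun h => ⟨⟨fun q => (h.2 q).1, h.1⟩,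
    fun q => (h.2 q).2⟩⟩

theorem isLift_lift (hV : V ∈ P.sections) : P.IsLift V (lift V 1) :=
  isLift_iff.2 ⟨smoothSectionAt_lift hV, isLiftAt_lift hV⟩

theorem IsLift.eq_lift {W : P.M 1 → LogFunctional (P.M 2)} (hV : V ∈ P.sections)
    (hW : P.IsLift V W) : W = lift V 1 :=
  funext fun q => (lift_eq hV ((isLift_iff.1 hW).2 q)).symm

theorem IsLift.pushC_eq {W : P.M 1 → LogFunctional (P.M 2)} (hV : V ∈ P.sections)
    (hW : P.IsLift V W) : P.pushC W = rightInvariant V 1 := by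
  have e1 : P.diag12 = P.dblFst 1 := congrArg P.S (funext fun i => by fin_cases i <;> rfl)
  have e2 : P.projC = P.dropSnd 1 := congrArg P.S (funext fun i => by fin_cases i <;> rfl)
  funext q
  rw [hW.eq_lift hV, pushC, rightInvariant, e1, e2]

end GeneralizedProduct

end

theorem mainTheorem4 {μ κ : ℕ} (P : GeneralizedProduct.{u} μ κ) :
    (∀ V ∈ P.sections, ∃! W, P.IsLift V W) ∧
    (∀ V ∈ P.sections, ∀ W, P.IsLift V W →
      P.pushC W ∈ CornerManifold.smoothSections id (CornerManifold.nullSpace P.projR) ∧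
      ∀ p, P.pushC W (P.diag p) = V p) ∧
    ∃! bracket : P.sections → P.sections → P.sections,
      (∀ (V₁ V₂ : P.sections) (W₁ W₂ : P.M 1 → CornerManifold.LogFunctional (P.M 2)),
        P.IsLift V₁.1 W₁ → P.IsLift V₂.1 W₂ → ∀ p,
          (bracket V₁ V₂).1 p =
            CornerManifold.bBracket (P.pushC W₁) (P.pushC W₂) (P.diag p)) ∧
      CornerManifold.IsLieAlgebroid P.diag P.E κ P.anchor bracket := by
  refine ⟨fun V hV => ⟨_, P.isLift_lift hV, fun W hW => hW.eq_lift hV⟩, fun V hV W hW => ?_,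
    P.bracket, ⟨fun V₁ V₂ W₁ W₂ h₁ h₂ p => ?_, P.isLieAlgebroid⟩, fun b hb => ?_⟩
  · rw [hW.pushC_eq hV]
    have h := GeneralizedProduct.rightInvariant_mem hV 1
    exact ⟨⟨fun q => ⟨h.1 q, GeneralizedProduct.bDiff_projR_rightInvariant hV q⟩, h.2⟩,
      GeneralizedProduct.rightInvariant_diag hV⟩
  · rw [h₁.pushC_eq V₁.2, h₂.pushC_eq V₂.2]
    rfl
  · funext V₁ V₂
    refine Subtype.ext (funext fun p => ?_)
    have h₁ := GeneralizedProduct.isLift_lift V₁.2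
    have h₂ := GeneralizedProduct.isLift_lift V₂.2
    rw [hb.1 V₁ V₂ _ _ h₁ h₂ p, h₁.pushC_eq V₁.2, h₂.pushC_eq V₂.2]
    rfl
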